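/- **Theorem 1.1.** All graphs are finite and simple. For a graph $F$ we write $v(F)$ and $e(F)$ for its numbers of vertices and edges. Let $d \ge 1$ be an integer. A bipartite graph $H=(A\cup B,E)$ is *$d$-bounded* if there are $\ell$ vertices in $A$, for some $1\le \ell\le d$, that are complete to $B$ (that is, adjacent to every vertex of $B$), and all other vertices of $A$ have degree at most $d$. For real numbers $c,t>0$, a graph $\Gamma$ is *$(c,t)$-sparse* if for all (not necessarily disjoint) $A,B\subseteq V(\Gamma)$ with $|A|,|B|\ge t$ we have $e_\Gamma(A,B)\le(1-c)|A||B|$, where $e_\Gamma(A,B)$ is the number of pairs $(a,b)\in A\times B$ such that $\{a,b\}$ is an edge of $\Gamma$. Let $H$ be a $d$-bounded bipartite graph and let $c>0$. Then there are constants $C,\alpha>0$ (depending only on $d$, $H$ and $c$) such that the following holds for every $t>0$ and every $(c,t)$-sparse graph $\Gamma$ with $n$ vertices. If $G\subseteq\Gamma$ is a subgraph with $V(G)=V(\Gamma)$ and $$e(G)\ \ge\ C\,t^{1/d}\,n^{2-1/d},$$ then $G$ contains at least $$\alpha\, q^{e(H)}\, n^{v(H)},\qquad q=\frac{2e(G)}{n^2},$$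 copies of $H$ (subgraphs of $G$ isomorphic to $H$) that are induced in $\Gamma$, that is, in which any two vertices that are adjacent in $\Gamma$ are joined by an edge of the copy. (For $n=0$ put $q=0$.) -/

import Mathlib

/-- A finite bipartite graph `H` is `d`-bounded if it has a bipartition `(A, B)` such that, for some
`1 ≤ ℓ ≤ d`, there are `ℓ` vertices in `A` (forming `A₀`) that are complete to `B`, and all other
vertices of `A` have degree at most `d`. -/
def SimpleGraph.IsDBounded {W : Type*} [Fintype W] (H : SimpleGraph W) (d : ℕ) : Prop :=
  ∃ A B : Set W, H.IsBipartiteWith A B ∧ A ∪ B = Set.univ ∧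
    ∃ A₀ : Set W, A₀ ⊆ A ∧ 1 ≤ A₀.ncard ∧ A₀.ncard ≤ d ∧
      (∀ a ∈ A₀, ∀ b ∈ B, H.Adj a b) ∧
      (∀ a ∈ A \ A₀, (H.neighborSet a).ncard ≤ d)

open Classical in
/-- `Γ` is `(c, t)`-sparse if `e(A, B) ≤ (1 - c)|A||B|` for all vertex subsets `A`, `B`, not
necessarily disjoint, of size at least `t`; `e(A, B)` is the number of ordered pairs
`(a, b) ∈ A × B` that are adjacent in `Γ`. -/
def SimpleGraph.IsSparse {V : Type*} [Fintype V] (Γ : SimpleGraph V) (c t : ℝ) : Prop :=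
  ∀ A B : Finset V, t ≤ (A.card : ℝ) → t ≤ (B.card : ℝ) →
    ((Γ.interedges A B).card : ℝ) ≤ (1 - c) * (A.card : ℝ) * (B.card : ℝ)

/-- The (unlabelled) copies of `H` in `G` that are induced in `Γ`: the subgraphs `K` of `G`
isomorphic to `H` such that any two vertices of `K` adjacent in `Γ` are already adjacent in `K`. -/
def SimpleGraph.inducedCopies {W V : Type*} (H : SimpleGraph W) (G Γ : SimpleGraph V) :
    Set G.Subgraph :=
  {K | Nonempty (H ≃g K.coe) ∧ ∀ x ∈ K.verts, ∀ y ∈ K.verts, Γ.Adj x y → K.Adj x y}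

/-! Put `R x y := Γ.Adj x y ∨ x = y`. Sparseness becomes `SparseRel`: with `τ` of order `t`, all but
`τ` vertices are unrelated to a fixed share of any given set of size at least `τ`. Maps of `H`
sending edges to edges of `G` and other pairs of distinct vertices to unrelated pairs are injective
and give induced copies, so such maps are counted. The edge hypothesis yields `C * t ≤ q ^ d * n`:
sets of order `q ^ s * n` with `s ≤ d` are large compared with `τ`.

The count is a form of dependent random choice. Let `A₀` be the vertices complete to `B`, and `A₁`
the rest of their side. Weight a placement `T` of `A₀` by the size of its common neighbourhood
`N(T)`; the total weight is the sum of the `ℓ`-th powers of the degrees, and independent `T` carry a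
constant share of it (`sum_independent_ge`). A placement `s` of the neighbourhood `S` of a vertex of
`A₁` is bad for `T` if it has fewer than `ε * q ^ #S * n` common neighbours, or if an entry of `T`
is related to too many of them. For fixed `s`, few values of one entry of `T` within `N(s)` cause
this: either `N(s)` itself is small, or sparseness applies. Averaging (`sum_bad_le`) leaves enough
weight on `T` with few bad tuples in `N(T)`.

For such `T`, many independent placements of `B` in `N(T)` avoid the bad subtuples, and sparseness
keeps a constant share of each extension set unrelated to `T` and to the rest of `B`. Independent
transversals of these sets place `A₁`. The powers of `q` and `n` multiply to `q ^ e(H) * n ^ v(H)`.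
-/

open Finset Function

/-! ### Sparse relations and heavy entries -/

open Classical in
/-- For every set `Y` of size at least `τ`, at most `τ` elements `x` are unrelated to fewer than a
`c`-fraction of `Y`. -/
def SparseRel {V : Type*} [Fintype V] (R : V → V → Prop) (c τ : ℝ) : Prop :=
  ∀ Y : Finset V, τ ≤ (#Y : ℝ) →
    (#{x : V | (#{y ∈ Y | ¬ R x y} : ℝ) < c * #Y} : ℝ) ≤ τ

/-- The entries of `x` are pairwise unrelated. -/
def Independent {V ι : Type*} (R : V → V → Prop) (x : ι → V) : Prop :=
  ∀ i j, i ≠ j → ¬ R (x i) (x j)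

open Classical in
/-- The elements of `Y` unrelated to all `x i`, `i ∈ U`. -/
noncomputable def freeSet {V ι : Type*} (R : V → V → Prop) (Y : Finset V) (x : ι → V)
    (U : Finset ι) : Finset V :=
  {v ∈ Y | ∀ i ∈ U, ¬ R (x i) v}

open Classical in
/-- The entry `x i` is related to more than a `(1 - c)`-fraction of some set `freeSet R Y x U` with
`U ⊆ A` that has not become too small. -/
def HeavyAt {V ι : Type*} (R : V → V → Prop) (c : ℝ) (Y : Finset V) (a : ℝ) (A : Finset ι)
    (i : ι) (x : ι → V) : Prop :=
  ∃ U ⊆ A, i ∉ U ∧ c ^ #U * a ≤ #(freeSet R Y x U) ∧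
    (#{y ∈ freeSet R Y x U | ¬ R (x i) y} : ℝ) < c * #(freeSet R Y x U)

/-- Impose the entries one at a time: each keeps a `c`-share, not being heavy over what the earlier
ones left. As `HeavyAt` ranges over all `U`, the order is immaterial. -/
theorem card_freeSet_of_not_heavyAt {V ι : Type*} {R : V → V → Prop} {c : ℝ} (hc : 0 < c)
    {Y : Finset V} {a : ℝ} (ha : a ≤ #Y) {A : Finset ι} {x : ι → V}
    (h : ∀ i ∈ A, ¬ HeavyAt R c Y a A i x) : c ^ #A * a ≤ #(freeSet R Y x A) := by
  classical
  suffices H : ∀ U : Finset ι, U ⊆ A → c ^ #U * a ≤ #(freeSet R Y x U) from H A subset_rfl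
  intro U
  induction U using Finset.induction_on with
  | empty => intro _; simpa [freeSet] using ha
  | insert i U hi ih =>
    intro hU
    have hUA := (Finset.subset_insert i U).trans hU
    have h1 := ih hUA
    have h2 := h i (hU (mem_insert_self i U))
    have h3 : c * #(freeSet R Y x U) ≤ (#{y ∈ freeSet R Y x U | ¬ R (x i) y} : ℝ) := by
      by_contra h4
      exact h2 ⟨U, hUA, hi, h1, by simpa using h4⟩
    have h5 : freeSet R Y x (insert i U) = {y ∈ freeSet R Y x U | ¬ R (x i) y} := by
      ext v
      simp only [freeSet, mem_filter, mem_insert, forall_eq_or_imp]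
      tauto
    rw [h5, card_insert_of_notMem hi, pow_succ]
    calc c ^ #U * c * a = c * (c ^ #U * a) := by ring
      _ ≤ c * #(freeSet R Y x U) := by gcongr
      _ ≤ _ := h3

theorem freeSet_update {V ι : Type*} [DecidableEq ι] (R : V → V → Prop) (Y : Finset V) (x : ι → V)
    {U : Finset ι} {i : ι} (hi : i ∉ U) (v : V) :
    freeSet R Y (update x i v) U = freeSet R Y x U := by
  ext w
  simp only [freeSet, mem_filter]
  refine and_congr_right fun _ => forall₂_congr fun j hj => ?_
  rw [update_of_ne (ne_of_mem_of_not_mem hj hi)]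

-- Changing `x i` does not affect the free sets with `i ∉ U`. Sparseness allows at most `τ` heavy
-- values for each of the at most `2 ^ #A` sets still above their threshold, the least of which is
-- `c ^ #A * a`.
open Classical in
theorem card_heavyAt_update_le {V ι : Type*} [Fintype V] {R : V → V → Prop} {c τ : ℝ}
    (hR : SparseRel R c τ) (hc : 0 < c) (hc1 : c ≤ 1) (Y : Finset V) {a : ℝ} (ha : 0 ≤ a)
    (A : Finset ι) (hτ : τ ≤ c ^ #A * a) (i : ι) (x : ι → V) :
    (#{v : V | HeavyAt R c Y a A i (update x i v)} : ℝ) ≤ 2 ^ #A * τ := by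
  set 𝒰 : Finset (Finset ι) := {U ∈ A.powerset | c ^ #U * a ≤ #(freeSet R Y x U)} with h𝒰
  have h1 : ({v : V | HeavyAt R c Y a A i (update x i v)} : Finset V) ⊆
      𝒰.biUnion fun U => {v : V | (#{y ∈ freeSet R Y x U | ¬ R v y} : ℝ) <
        c * #(freeSet R Y x U)} := by
    intro v hv
    obtain ⟨U, hU, hi, h2, h3⟩ := (mem_filter.1 hv).2
    rw [freeSet_update R Y x hi] at h2 h3
    rw [update_self] at h3
    rw [mem_biUnion]
    exact ⟨U, by simp [h𝒰, hU, h2], by simpa using h3⟩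
  have hbd : ∀ U ∈ 𝒰, (#({v : V | (#{y ∈ freeSet R Y x U | ¬ R v y} : ℝ) <
        c * #(freeSet R Y x U)} : Finset V) : ℝ) ≤ τ := by
    intro U hU
    simp only [h𝒰, mem_filter, mem_powerset] at hU
    refine hR _ (hτ.trans (le_trans ?_ hU.2))
    gcongr ?_ * a
    exact pow_le_pow_of_le_one hc.le hc1 (card_le_card hU.1)
  calc (#{v : V | HeavyAt R c Y a A i (update x i v)} : ℝ)
      ≤ ∑ U ∈ 𝒰, (#({v : V | (#{y ∈ freeSet R Y x U | ¬ R v y} : ℝ) <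
        c * #(freeSet R Y x U)} : Finset V) : ℝ) := by
        exact_mod_cast (card_le_card h1).trans card_biUnion_le
    _ ≤ ∑ U ∈ 𝒰, τ := sum_le_sum hbd
    _ = #𝒰 * τ := by simp
    _ ≤ 2 ^ #A * τ := by
      have h4 : 0 ≤ τ := by
        by_contra hneg
        have h5 := hR ∅ (by simpa using (not_le.1 hneg).le)
        exact hneg ((Nat.cast_nonneg _).trans h5)
      gcongr
      have : #𝒰 ≤ #A.powerset := card_filter_le _ _
      rw [card_powerset] at this
      exact_mod_cast this

/-! ### Resampling a coordinate -/

/-- Resampling one coordinate of a function. -/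
theorem sum_piFinset_update {V ι : Type*} [Fintype ι] [DecidableEq ι] (Z : Finset V) (i : ι)
    (f : (ι → V) → ℝ) :
    ∑ y ∈ Fintype.piFinset (fun _ : ι => Z), ∑ v ∈ Z, f (update y i v) =
      #Z * ∑ y ∈ Fintype.piFinset (fun _ : ι => Z), f y := by
  -- Exchanging `y i` with the fresh value `v` is an involution on pairs.
  have h : ∑ p ∈ Fintype.piFinset (fun _ : ι => Z) ×ˢ Z, f (update p.1 i p.2) =
      ∑ p ∈ Fintype.piFinset (fun _ : ι => Z) ×ˢ Z, f p.1 := by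
    have hmem : ∀ p ∈ Fintype.piFinset (fun _ : ι => Z) ×ˢ Z,
        (update p.1 i p.2, p.1 i) ∈ Fintype.piFinset (fun _ : ι => Z) ×ˢ Z := by
      rintro ⟨y, v⟩ hp
      simp only [mem_product, Fintype.mem_piFinset] at hp ⊢
      refine ⟨fun j => ?_, hp.1 i⟩
      rcases eq_or_ne j i with rfl | hj
      · simpa using hp.2
      · simpa [hj] using hp.1 j
    exact Finset.sum_bij' (fun p _ => (update p.1 i p.2, p.1 i))
      (fun p _ => (update p.1 i p.2, p.1 i)) hmem hmem (by simp) (by simp) (by simp)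
  rw [sum_product, sum_product] at h
  rw [h]
  simp [mul_sum]

open Classical in
theorem card_mul_card_filter_piFinset_le {V ι : Type*} [Fintype ι] (Z : Finset V) (i : ι)
    (Q : (ι → V) → Prop) (m : ℝ)
    (h : ∀ y : ι → V, (#{v ∈ Z | Q (update y i v)} : ℝ) ≤ m) :
    (#Z : ℝ) * #{y ∈ Fintype.piFinset (fun _ : ι => Z) | Q y} ≤ m * (#Z : ℝ) ^ Fintype.card ι := by
  have h1 := sum_piFinset_update Z i (fun y => if Q y then (1 : ℝ) else 0)
  rw [card_filter, Nat.cast_sum]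
  push_cast
  rw [← h1]
  calc _ ≤ ∑ y ∈ Fintype.piFinset (fun _ : ι => Z), m := by
        refine sum_le_sum fun y _ => ?_
        have := h y
        rw [card_filter] at this
        push_cast at this
        exact this
    _ = m * (#Z : ℝ) ^ Fintype.card ι := by
        simp [Fintype.card_piFinset, mul_comm]

/-! ### Independent transversals -/

-- Greedy choice: half of `Z 0` is heavy towards none of the other sets; after such a first entry
-- every other set keeps a `c`-share, and induction applies to these shares.
set_option maxHeartbeats 400000 in
open Classical in
theorem exists_card_independent_fin (c : ℝ) (hc : 0 < c) (m : ℕ) :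
    ∃ M γ : ℝ, 0 < M ∧ 0 < γ ∧ ∀ (V : Type*) [Fintype V] (R : V → V → Prop) (τ : ℝ),
      (∀ x y, R x y → R y x) → 0 ≤ τ → SparseRel R c τ → ∀ Z : Fin m → Finset V,
      (∀ i, M * τ ≤ #(Z i)) →
      γ * ∏ i, (#(Z i) : ℝ) ≤
        #{z ∈ Fintype.piFinset Z | Independent R z} := by
  induction m with
  | zero =>
    refine ⟨1, 1, one_pos, one_pos, fun V _ R τ _ _ _ Z _ => ?_⟩
    simp [Independent]
  | succ m ih =>
    obtain ⟨M, γ, hM, hγ, H⟩ := ih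
    -- `M / c` keeps the shrunken sets above `M * τ`, `1` makes sparseness applicable, and `2 * m`
    -- ensures that the `m` families of heavy vertices cover at most half of `Z 0`.
    refine ⟨max (M / c) (max 1 (2 * m)), γ * c ^ m / 2, by positivity, by positivity, ?_⟩
    intro V _ R τ hsymm hτ hR Z hZ
    have hZ1 : ∀ i, τ ≤ #(Z i) := fun i => le_trans (by
      have : 1 ≤ max (M / c) (max 1 (2 * (m : ℝ))) := (le_max_left _ _).trans (le_max_right _ _)
      nlinarith) (hZ i)
    have hZ2 : ∀ i, M * τ ≤ c * #(Z i) := fun i => by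
      have h1 : M / c ≤ max (M / c) (max 1 (2 * (m : ℝ))) := le_max_left _ _
      have h2 : M / c * τ ≤ #(Z i) := le_trans (by gcongr) (hZ i)
      rw [div_mul_eq_mul_div, div_le_iff₀ hc] at h2
      linarith
    have hZ3 : m * τ ≤ #(Z 0) / 2 := by
      have h1 : 2 * (m : ℝ) ≤ max (M / c) (max 1 (2 * (m : ℝ))) :=
        (le_max_right _ _).trans (le_max_right _ _)
      have h2 : 2 * (m : ℝ) * τ ≤ #(Z 0) := le_trans (by gcongr) (hZ 0)
      linarith
    set heavy : Fin m → Finset V := fun i =>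
      {x : V | (#{y ∈ Z i.succ | ¬ R x y} : ℝ) < c * #(Z i.succ)} with hheavy
    set Z₀ : Finset V := Z 0 \ univ.biUnion heavy with hZ₀
    have hZ₀card : (#(Z 0) : ℝ) / 2 ≤ #Z₀ := by
      have h1 : (#(Z 0) : ℝ) ≤ #Z₀ + #(univ.biUnion heavy) := by
        exact_mod_cast tsub_le_iff_right.1 (le_card_sdiff (univ.biUnion heavy) (Z 0))
      have h2 : (#(univ.biUnion heavy) : ℝ) ≤ m * τ := by
        calc (#(univ.biUnion heavy) : ℝ) ≤ ∑ i, (#(heavy i) : ℝ) := by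
              exact_mod_cast card_biUnion_le
          _ ≤ ∑ i : Fin m, τ := sum_le_sum fun i _ => hR _ (hZ1 _)
          _ = m * τ := by simp
      linarith
    set Z' : V → Fin m → Finset V := fun v i => {y ∈ Z i.succ | ¬ R v y} with hZ'
    have hZ'card : ∀ v ∈ Z₀, ∀ i, c * #(Z i.succ) ≤ #(Z' v i) := by
      intro v hv i
      simp only [hZ₀, hheavy, mem_sdiff, mem_biUnion, mem_univ, true_and, mem_filter,
        not_exists, not_lt] at hv
      exact hv.2 i
    set good : V → Finset (Fin m → V) := fun v =>
      {z ∈ Fintype.piFinset (Z' v) | Independent R z} with hgood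
    have hgc : ∀ v ∈ Z₀, γ * c ^ m * ∏ i : Fin m, (#(Z i.succ) : ℝ) ≤ #(good v) := by
      intro v hv
      refine le_trans ?_ (H V R τ hsymm hτ hR (Z' v) fun i => (hZ2 _).trans (hZ'card v hv i))
      have : ∏ i : Fin m, (c * (#(Z i.succ) : ℝ)) ≤ ∏ i, (#(Z' v i) : ℝ) :=
        prod_le_prod (fun i _ => by positivity) fun i _ => hZ'card v hv i
      rw [prod_mul_distrib, prod_const, card_univ, Fintype.card_fin] at this
      calc γ * c ^ m * ∏ i : Fin m, (#(Z i.succ) : ℝ) = γ * (c ^ m * ∏ i : Fin m, (#(Z i.succ) : ℝ)) := by ring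
        _ ≤ _ := by gcongr
    have hinj : #(Z₀.sigma good) ≤
        #{z ∈ Fintype.piFinset Z | Independent R z} := by
      refine card_le_card_of_injOn (fun p => Fin.cons p.1 p.2) ?_ ?_
      · rintro ⟨v, z⟩ hp
        simp only [coe_sigma, Set.mem_sigma_iff, mem_coe, hgood, mem_filter,
          Fintype.mem_piFinset, hZ'] at hp
        obtain ⟨hv, hz, hzR⟩ := hp
        simp only [coe_filter, Set.mem_ofPred_eq, Fintype.mem_piFinset]
        refine ⟨fun i => ?_, fun i j => ?_⟩
        · refine Fin.cases ?_ (fun i => ?_) i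
          · simpa using (mem_sdiff.1 hv).1
          · simpa using (hz i).1
        · refine Fin.cases ?_ (fun i => ?_) i <;> refine Fin.cases ?_ (fun j => ?_) j
          · simp
          · intro _; simpa using (hz j).2
          · intro _ h; exact (hz i).2 (hsymm _ _ (by simpa using h))
          · intro hij; simpa using hzR i j (fun h => hij (by rw [h]))
      · rintro ⟨v, z⟩ _ ⟨v', z'⟩ _ h
        obtain ⟨rfl, rfl⟩ := Fin.cons_injective2 h
        rfl
    have hprod : (0 : ℝ) ≤ ∏ i : Fin m, (#(Z i.succ) : ℝ) := prod_nonneg fun _ _ => by positivity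
    rw [Fin.prod_univ_succ]
    generalize (∏ i : Fin m, (#(Z i.succ) : ℝ)) = P at hprod hgc ⊢
    have h1 : ∑ v ∈ Z₀, γ * c ^ m * P ≤ ∑ v ∈ Z₀, (#(good v) : ℝ) := sum_le_sum hgc
    rw [sum_const, nsmul_eq_mul, ← Nat.cast_sum, ← card_sigma] at h1
    have h2 : (#(Z 0) : ℝ) / 2 * (γ * c ^ m * P) ≤ #Z₀ * (γ * c ^ m * P) :=
      mul_le_mul_of_nonneg_right hZ₀card (by positivity)
    have h3 := (h2.trans h1).trans (Nat.cast_le.2 hinj)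
    refine le_trans (le_of_eq ?_) h3
    generalize (#(Z 0) : ℝ) = z
    ring

open Classical in
/-- In a sparse relation, a positive proportion of the transversals of large sets is independent. -/
theorem exists_card_independent (c : ℝ) (hc : 0 < c) (ι : Type*) [Fintype ι] :
    ∃ M γ : ℝ, 0 < M ∧ 0 < γ ∧ ∀ (V : Type*) [Fintype V] (R : V → V → Prop) (τ : ℝ),
      (∀ x y, R x y → R y x) → 0 ≤ τ → SparseRel R c τ → ∀ Z : ι → Finset V,
      (∀ i, M * τ ≤ #(Z i)) →
      γ * ∏ i, (#(Z i) : ℝ) ≤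
        #{z ∈ Fintype.piFinset Z | Independent R z} := by
  obtain ⟨M, γ, hM, hγ, H⟩ := exists_card_independent_fin c hc (Fintype.card ι)
  refine ⟨M, γ, hM, hγ, fun V _ R τ hsymm hτ hR Z hZ => ?_⟩
  let e := Fintype.equivFin ι
  have h1 := H V R τ hsymm hτ hR (fun i => Z (e.symm i)) fun i => hZ _
  rw [Equiv.prod_comp e.symm (fun i => (#(Z i) : ℝ))] at h1
  refine h1.trans ?_
  refine Nat.cast_le.2 (card_le_card_of_injOn (fun z i => z (e i)) ?_ ?_)
  · intro z hz
    simp only [coe_filter, Set.mem_ofPred_eq, Fintype.mem_piFinset] at hz ⊢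
    exact ⟨fun i => by simpa using hz.1 (e i), fun i j hij => hz.2 _ _ (e.injective.ne hij)⟩
  · intro z _ z' _ h
    funext i
    simpa using congrFun h (e.symm i)

/-! ### Common neighbourhoods and degree powers -/

open Classical in
/-- The common neighbourhood of the entries of `T`. -/
noncomputable def commonNbrs {V ι : Type*} [Fintype V] (G : SimpleGraph V) (T : ι → V) :
    Finset V :=
  {v | ∀ i, G.Adj (T i) v}

theorem mem_commonNbrs {V ι : Type*} [Fintype V] {G : SimpleGraph V} {T : ι → V} {v : V} :
    v ∈ commonNbrs G T ↔ ∀ i, G.Adj (T i) v := by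
  simp [commonNbrs]

open Classical in
theorem sum_filter_card_commonNbrs {V ι : Type*} [Fintype V] [Fintype ι] (G : SimpleGraph V)
    (p : (ι → V) → Prop) :
    ∑ T : ι → V with p T, (#(commonNbrs G T) : ℝ) =
      ∑ v, (#{T ∈ Fintype.piFinset (fun _ : ι => G.neighborFinset v) | p T} : ℝ) := by
  have h : ∀ T : ι → V, (#(commonNbrs G T) : ℝ) =
      ∑ v, if (∀ i, G.Adj v (T i)) then (1 : ℝ) else 0 := by
    intro T
    simp [commonNbrs, G.adj_comm]
  simp_rw [h]
  rw [sum_comm]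
  refine sum_congr rfl fun v _ => ?_
  rw [← Finset.sum_filter, filter_filter]
  simp only [sum_const, nsmul_eq_mul, mul_one, Nat.cast_inj]
  congr 1
  ext T
  simp [Fintype.mem_piFinset, and_comm]

open Classical in
theorem sum_card_commonNbrs_ne {V ι : Type*} [Fintype V] [Fintype ι] (G : SimpleGraph V) (i : ι) :
    ∑ T : ι → V, (#{v : V | ∀ j, j ≠ i → G.Adj (T j) v} : ℝ) =
      Fintype.card V * ∑ v, (G.degree v : ℝ) ^ (Fintype.card ι - 1) := by
  have h : ∀ T : ι → V, (#{v : V | ∀ j, j ≠ i → G.Adj (T j) v} : ℝ) =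
      ∑ v, if (∀ j, j ≠ i → G.Adj v (T j)) then (1 : ℝ) else 0 := by
    intro T
    simp [G.adj_comm]
  simp_rw [h]
  rw [sum_comm, mul_sum]
  refine sum_congr rfl fun v _ => ?_
  have h2 : ({T : ι → V | ∀ j, j ≠ i → G.Adj v (T j)} : Finset (ι → V)) =
      Fintype.piFinset (fun j => if j = i then univ else G.neighborFinset v) := by
    ext T
    simp only [mem_filter, mem_univ, true_and, Fintype.mem_piFinset]
    refine forall_congr' fun j => ?_
    by_cases hj : j = i <;> simp [hj]
  rw [← Finset.sum_filter, h2, sum_const, nsmul_eq_mul, mul_one, Fintype.card_piFinset,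
    ← mul_prod_erase univ _ (mem_univ i), if_pos rfl,
    prod_congr rfl (g := fun _ => G.degree v) (fun j hj => by simp [ne_of_mem_erase hj])]
  simp [card_erase_of_mem]

-- Chebyshev's sum inequality for the similarly ordered sequences `deg` and `deg ^ (l - 1)`.
open Classical in
theorem mul_sum_degree_pow_le {V : Type*} [Fintype V] (G : SimpleGraph V) (q : ℝ) (l : ℕ)
    (hl : 1 ≤ l) (hn : 0 < Fintype.card V)
    (hq : q * (Fintype.card V : ℝ) ^ 2 = ∑ v, (G.degree v : ℝ)) :
    q * Fintype.card V * ∑ v, (G.degree v : ℝ) ^ (l - 1) ≤ ∑ v, (G.degree v : ℝ) ^ l := by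
  have hmono : MonovaryOn (fun v => (G.degree v : ℝ)) (fun v => (G.degree v : ℝ) ^ (l - 1))
      (univ : Finset V) := by
    intro u _ v _ h
    by_contra h2
    exact absurd h (not_lt.2 (pow_le_pow_left₀ (by positivity) (not_le.1 h2).le _))
  have h := hmono.sum_mul_sum_le_card_mul_sum
  have h3 : ∀ v, (G.degree v : ℝ) * (G.degree v : ℝ) ^ (l - 1) = (G.degree v : ℝ) ^ l := by
    intro v
    rw [← pow_succ', Nat.sub_add_cancel hl]
  simp_rw [h3] at h
  rw [← hq, card_univ] at h
  have hn' : (0 : ℝ) < Fintype.card V := by exact_mod_cast hn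
  refine le_of_mul_le_mul_left ?_ hn'
  calc _ = _ := by ring
    _ ≤ _ := h

open Classical in
theorem pow_le_sum_degree_pow {V : Type*} [Fintype V] (G : SimpleGraph V) (q : ℝ) (hq0 : 0 ≤ q)
    (l : ℕ) (hn : 0 < Fintype.card V)
    (hq : q * (Fintype.card V : ℝ) ^ 2 = ∑ v, (G.degree v : ℝ)) :
    q ^ l * (Fintype.card V : ℝ) ^ (l + 1) ≤ ∑ v, (G.degree v : ℝ) ^ l := by
  induction l with
  | zero => simp
  | succ l ih =>
    refine le_trans ?_ (mul_sum_degree_pow_le G q (l + 1) (by omega) hn hq)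
    calc _ = q * Fintype.card V * (q ^ l * (Fintype.card V : ℝ) ^ (l + 1)) := by ring
      _ ≤ _ := by
        rw [Nat.add_sub_cancel]
        gcongr

/-! ### Averaging over bad pairs of tuples -/

open Classical in
/-- The averaging step over one coordinate. -/
theorem sum_update_bad_le {V ι σ : Type*} [Fintype V] [Fintype ι] [Fintype σ] (G : SimpleGraph V)
    {q : ℝ} (hq0 : 0 < q) (i : ι) (P : (ι → V) → (σ → V) → Prop) {δ κ ε : ℝ} (hδ : 0 < δ)
    (hκ : 0 < κ) (hκ1 : κ ≤ 1) (hε : 0 ≤ ε) (T : ι → V)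
    (hP : ∀ S : σ → V, (#{x ∈ commonNbrs G S | P (update T i x) S} : ℝ) ≤
      ε * q ^ max (Fintype.card σ) 1 * Fintype.card V) :
    ∑ x, (if δ * (#(commonNbrs G (update T i x)) : ℝ) ^ Fintype.card σ <
        #{S ∈ Fintype.piFinset (fun _ : σ => commonNbrs G (update T i x)) |
          P (update T i x) S} then (#(commonNbrs G (update T i x)) : ℝ) else 0) ≤
      (κ + ε / (δ * κ ^ Fintype.card σ)) * (q * Fintype.card V) *
        #{v : V | ∀ j, j ≠ i → G.Adj (T j) v} := by
  set F : Finset V := {v : V | ∀ j, j ≠ i → G.Adj (T j) v} with hF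
  set w : V → ℝ := fun x => (#(commonNbrs G (update T i x)) : ℝ) with hw
  set B : V → ℝ := fun x => (#{S ∈ Fintype.piFinset
    (fun _ : σ => commonNbrs G (update T i x)) | P (update T i x) S} : ℝ) with hB
  have hsub : ∀ x, commonNbrs G (update T i x) ⊆ F := by
    intro x v hv
    rw [mem_commonNbrs] at hv
    simp only [hF, mem_filter, mem_univ, true_and]
    intro j hj
    simpa [hj] using hv j
  have hwF : ∀ x, w x ≤ #F := fun x => Nat.cast_le.2 (card_le_card (hsub x))
  have hw0 : ∀ x, 0 ≤ w x := fun x => Nat.cast_nonneg _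
  have hB0 : ∀ x, 0 ≤ B x := fun x => Nat.cast_nonneg _
  -- Double counting of pairs `(x, S)`: `S` lies in the common neighbourhood only if `S` lies in `F`
  -- and `x` is a common neighbour of `S`, so `hP` applies for each `S`.
  have hBsum : ∑ x, B x ≤
      (#F : ℝ) ^ Fintype.card σ * (ε * q ^ max (Fintype.card σ) 1 * Fintype.card V) := by
    have h1 : ∀ x, B x ≤ ∑ S ∈ Fintype.piFinset (fun _ : σ => F),
        if x ∈ commonNbrs G S ∧ P (update T i x) S then (1 : ℝ) else 0 := by
      intro x
      rw [← Finset.sum_filter, sum_const, nsmul_eq_mul, mul_one, hB]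
      refine Nat.cast_le.2 (card_le_card fun S hS => ?_)
      simp only [mem_filter, Fintype.mem_piFinset] at hS ⊢
      refine ⟨fun a => hsub x (hS.1 a), ?_, hS.2⟩
      rw [mem_commonNbrs]
      intro a
      have := mem_commonNbrs.1 (hS.1 a) i
      rw [update_self] at this
      exact this.symm
    calc ∑ x, B x ≤ ∑ x, ∑ S ∈ Fintype.piFinset (fun _ : σ => F),
        if x ∈ commonNbrs G S ∧ P (update T i x) S then (1 : ℝ) else 0 :=
          sum_le_sum fun x _ => h1 x
      _ = ∑ S ∈ Fintype.piFinset (fun _ : σ => F),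
          (#{x ∈ commonNbrs G S | P (update T i x) S} : ℝ) := by
          rw [sum_comm]
          refine sum_congr rfl fun S _ => ?_
          rw [← Finset.sum_filter, sum_const, nsmul_eq_mul, mul_one]
          congr 2
          ext x
          simp
      _ ≤ ∑ S ∈ Fintype.piFinset (fun _ : σ => F),
          (ε * q ^ max (Fintype.card σ) 1 * Fintype.card V) := sum_le_sum fun S _ => hP S
      _ = _ := by
          rw [sum_const, nsmul_eq_mul, Fintype.card_piFinset, prod_const, card_univ]
          push_cast
          ring
  change ∑ x, (if δ * w x ^ Fintype.card σ < B x then w x else 0) ≤ _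
  clear_value w B
  have hF0 : (0 : ℝ) ≤ #F := Nat.cast_nonneg _
  generalize (#F : ℝ) = f at *
  have hn0 : (0 : ℝ) ≤ Fintype.card V := Nat.cast_nonneg _
  have hcard : ∑ _x : V, (1 : ℝ) = Fintype.card V := by simp
  generalize (Fintype.card V : ℝ) = n at *
  -- For empty `σ` the weight is simply bounded by `f`; the factor `q` then comes from the exponent
  -- `max 0 1`.
  rcases Nat.eq_zero_or_pos (Fintype.card σ) with hs | hs
  · rw [hs] at hBsum ⊢
    have h1 : ∀ x, (if δ * w x ^ 0 < B x then w x else 0) ≤ f / δ * B x := by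
      intro x
      split_ifs with h
      · rw [pow_zero, mul_one] at h
        rw [div_mul_eq_mul_div, le_div_iff₀ hδ]
        exact mul_le_mul (hwF x) h.le hδ.le hF0
      · have := hB0 x
        positivity
    calc _ ≤ ∑ x, f / δ * B x := sum_le_sum fun x _ => h1 x
      _ = f / δ * ∑ x, B x := by rw [mul_sum]
      _ ≤ f / δ * (f ^ 0 * (ε * q ^ max 0 1 * n)) := by gcongr
      _ = ε / δ * (q * n) * f := by simp; ring
      _ ≤ (κ + ε / (δ * κ ^ 0)) * (q * n) * f := by
          rw [pow_zero, mul_one]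
          gcongr
          linarith
  · obtain ⟨r, hr⟩ : ∃ r, Fintype.card σ = r + 1 := ⟨_, (Nat.sub_add_cancel hs).symm⟩
    rw [hr] at hBsum ⊢
    rw [max_eq_left (by omega)] at hBsum
    rcases hF0.eq_or_lt with hf | hf
    · have h1 : ∀ x, (if δ * w x ^ (r + 1) < B x then w x else 0) ≤ 0 := by
        intro x
        have := hwF x
        split_ifs <;> linarith
      calc _ ≤ ∑ x : V, (0 : ℝ) := sum_le_sum fun x _ => h1 x
        _ ≤ _ := by rw [sum_const_zero]; positivity
    -- Values with `w x ≤ κ * q * f` contribute little altogether; above this cutoff, `δ * w x ^ (r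
    -- + 1) < B x` bounds `w x` by a multiple of `B x`, which is summed by `hBsum`.
    · have h1 : ∀ x, (if δ * w x ^ (r + 1) < B x then w x else 0) ≤
          κ * q * f * 1 + (δ * (κ * q * f) ^ r)⁻¹ * B x := by
        intro x
        have hb := hB0 x
        split_ifs with h
        · rcases le_or_gt (w x) (κ * q * f) with h2 | h2
          · have : 0 ≤ (δ * (κ * q * f) ^ r)⁻¹ * B x := by positivity
            linarith
          · have h3 : w x ≤ (δ * (κ * q * f) ^ r)⁻¹ * B x := by
              rw [inv_mul_eq_div, le_div_iff₀ (by positivity)]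
              have := hw0 x
              calc w x * (δ * (κ * q * f) ^ r) ≤ w x * (δ * w x ^ r) := by gcongr
                _ = δ * w x ^ (r + 1) := by ring
                _ ≤ B x := h.le
            have : 0 ≤ κ * q * f := by positivity
            linarith
        · positivity
      calc _ ≤ ∑ x, (κ * q * f * 1 + (δ * (κ * q * f) ^ r)⁻¹ * B x) :=
            sum_le_sum fun x _ => h1 x
        _ = κ * q * f * n + (δ * (κ * q * f) ^ r)⁻¹ * ∑ x, B x := by
            rw [sum_add_distrib, ← mul_sum, ← mul_sum, hcard]
        _ ≤ κ * q * f * n + (δ * (κ * q * f) ^ r)⁻¹ * (f ^ (r + 1) * (ε * q ^ (r + 1) * n)) := by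
            gcongr
        _ = (κ + ε / (δ * κ ^ r)) * (q * n) * f := by
            rw [mul_pow, mul_pow]
            field_simp
            ring
        _ ≤ (κ + ε / (δ * κ ^ (r + 1))) * (q * n) * f := by
            have : κ ^ (r + 1) ≤ κ ^ r := pow_le_pow_of_le_one hκ.le hκ1 (by omega)
            gcongr

open Classical in
/-- If, for fixed `S`, few values of the coordinate `i` make `(T, S)` bad, then the tuples `T` whose
common neighbourhood contains many bad tuples `S` carry little weight. -/
theorem sum_bad_le {V ι σ : Type*} [Fintype V] [Fintype ι] [Fintype σ] (G : SimpleGraph V)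
    {q : ℝ} (hq0 : 0 < q) (hn : 0 < Fintype.card V)
    (hq : q * (Fintype.card V : ℝ) ^ 2 = ∑ v, (G.degree v : ℝ))
    (i : ι) (P : (ι → V) → (σ → V) → Prop) {δ κ ε : ℝ} (hδ : 0 < δ)
    (hκ : 0 < κ) (hκ1 : κ ≤ 1) (hε : 0 ≤ ε)
    (hP : ∀ (T : ι → V) (S : σ → V), (#{x ∈ commonNbrs G S | P (update T i x) S} : ℝ) ≤
      ε * q ^ max (Fintype.card σ) 1 * Fintype.card V) :
    ∑ T : ι → V with δ * (#(commonNbrs G T) : ℝ) ^ Fintype.card σ <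
        #{S ∈ Fintype.piFinset (fun _ : σ => commonNbrs G T) | P T S},
      (#(commonNbrs G T) : ℝ) ≤
      (κ + ε / (δ * κ ^ Fintype.card σ)) * ∑ v, (G.degree v : ℝ) ^ Fintype.card ι := by
  have hn' : (0 : ℝ) < Fintype.card V := by exact_mod_cast hn
  rw [Finset.sum_filter]
  have h1 := sum_piFinset_update (univ : Finset V) i (fun T : ι → V =>
    if δ * (#(commonNbrs G T) : ℝ) ^ Fintype.card σ <
        #{S ∈ Fintype.piFinset (fun _ : σ => commonNbrs G T) | P T S}
      then (#(commonNbrs G T) : ℝ) else 0)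
  rw [Fintype.piFinset_univ, card_univ] at h1
  refine le_of_mul_le_mul_left ?_ hn'
  rw [← h1]
  refine (sum_le_sum fun T _ =>
    sum_update_bad_le G hq0 i P hδ hκ hκ1 hε T (hP T)).trans ?_
  rw [← mul_sum, sum_card_commonNbrs_ne]
  have h2 := mul_sum_degree_pow_le G q (Fintype.card ι) (Fintype.card_pos_iff.2 ⟨i⟩) hn hq
  have h3 : 0 ≤ κ + ε / (δ * κ ^ Fintype.card σ) := by positivity
  calc _ = Fintype.card V * ((κ + ε / (δ * κ ^ Fintype.card σ)) *
        (q * Fintype.card V * ∑ v, (G.degree v : ℝ) ^ (Fintype.card ι - 1))) := by ring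
    _ ≤ _ := by gcongr

/-- The tuple `s` has few common neighbours, or the entry `T i` is related to too many of them. -/
def BadAt {V ι σ : Type*} [Fintype V] [Fintype ι] (G : SimpleGraph V) (R : V → V → Prop) (c a : ℝ)
    (i : ι) (T : ι → V) (s : σ → V) : Prop :=
  (#(commonNbrs G s) : ℝ) < a ∨ HeavyAt R c (commonNbrs G s) a univ i T

-- If `s` has few common neighbours, the values `x` counted lie in that small set; otherwise only
-- heaviness can occur, and `card_heavyAt_update_le` bounds it.
open Classical in
theorem card_badAt_update_le {V ι σ : Type*} [Fintype V] [Fintype ι] [Fintype σ]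
    {G : SimpleGraph V} {R : V → V → Prop} {c τ q ε : ℝ} (hR : SparseRel R c τ) (hc : 0 < c)
    (hc1 : c ≤ 1) (hq0 : 0 < q) (hε : 0 < ε) (hε1 : ε ≤ 1)
    (hτ : τ ≤ c ^ Fintype.card ι * (ε * q ^ Fintype.card σ * Fintype.card V))
    (hτ2 : 2 ^ Fintype.card ι * τ ≤ ε * q ^ max (Fintype.card σ) 1 * Fintype.card V)
    (i : ι) (T : ι → V) (s : σ → V) :
    (#{x ∈ commonNbrs G s |
      BadAt G R c (ε * q ^ Fintype.card σ * Fintype.card V) i (update T i x) s} : ℝ) ≤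
      ε * q ^ max (Fintype.card σ) 1 * Fintype.card V := by
  rcases lt_or_ge (#(commonNbrs G s) : ℝ) (ε * q ^ Fintype.card σ * Fintype.card V) with h | h
  · have h0 : 0 < Fintype.card σ := by
      rw [Nat.pos_iff_ne_zero]
      intro h0
      have := Fintype.card_eq_zero_iff.1 h0
      have h1 : commonNbrs G s = univ := by
        ext v
        simp [mem_commonNbrs]
      rw [h1, h0, pow_zero, mul_one, card_univ] at h
      have : (0 : ℝ) ≤ Fintype.card V := Nat.cast_nonneg _
      nlinarith
    rw [max_eq_left (by omega)]
    refine le_trans ?_ h.le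
    exact Nat.cast_le.2 (card_filter_le _ _)
  · refine le_trans ?_ hτ2
    refine le_trans ?_ (card_heavyAt_update_le hR hc hc1 (commonNbrs G s)
      (a := ε * q ^ Fintype.card σ * Fintype.card V) (by positivity) univ
      (by simpa using hτ) i T)
    refine Nat.cast_le.2 (card_le_card fun x hx => ?_)
    exact mem_filter.2 ⟨mem_univ _, (mem_filter.1 hx).2.resolve_left (not_lt.2 h)⟩

/-! ### Extending a good tuple -/

open Classical in
theorem card_filter_restrict_le {V J : Type*} [Fintype J] (Z : Finset V) (S : Finset J)
    (p : (S → V) → Prop) {δ : ℝ}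
    (h : (#{s ∈ Fintype.piFinset (fun _ : S => Z) | p s} : ℝ) ≤ δ * (#Z : ℝ) ^ #S) :
    (#{y ∈ Fintype.piFinset (fun _ : J => Z) | p (fun j : S => y j)} : ℝ) ≤
      δ * (#Z : ℝ) ^ Fintype.card J := by
  have h1 : #{y ∈ Fintype.piFinset (fun _ : J => Z) | p (fun j : S => y j)} ≤
      #({s ∈ Fintype.piFinset (fun _ : S => Z) | p s} ×ˢ
        Fintype.piFinset (fun _ : (Sᶜ : Finset J) => Z)) := by
    refine card_le_card_of_injOn
      (fun y => ((fun j : S => y j), (fun j : (Sᶜ : Finset J) => y j))) ?_ ?_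
    · intro y hy
      simp only [coe_filter, Set.mem_ofPred_eq, Fintype.mem_piFinset] at hy
      simp only [coe_product, Set.mem_prod, mem_coe, mem_filter, Fintype.mem_piFinset]
      exact ⟨⟨fun j => hy.1 _, hy.2⟩, fun j => hy.1 _⟩
    · intro y _ y' _ h
      simp only [Prod.mk.injEq] at h
      funext j
      by_cases hj : j ∈ S
      · exact congrFun h.1 ⟨j, hj⟩
      · exact congrFun h.2 ⟨j, mem_compl.2 hj⟩
  rw [card_product, Fintype.card_piFinset] at h1
  simp only [prod_const, card_univ, Fintype.card_coe] at h1
  calc _ ≤ (#{s ∈ Fintype.piFinset (fun _ : S => Z) | p s} : ℝ) * (#Z : ℝ) ^ #Sᶜ := by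
        exact_mod_cast h1
    _ ≤ δ * (#Z : ℝ) ^ #S * (#Z : ℝ) ^ #Sᶜ := by gcongr
    _ = _ := by rw [mul_assoc, ← pow_add, card_add_card_compl]

open Classical in
/-- Most tuples in a set `Z` in which few restrictions are bad satisfy the conditions that make all
extension sets large. -/
theorem card_good_extension_ge {V ι J K : Type*} [Fintype V] [Fintype ι] [Fintype J] [Fintype K]
    {G : SimpleGraph V} {R : V → V → Prop} {c τ : ℝ} (hR : SparseRel R c τ) (hc : 0 < c)
    (hc1 : c ≤ 1) (S : K → Finset J) (a : K → ℝ) (ha : ∀ k, 0 ≤ a k) (T : ι → V) (Z : Finset V)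
    {δ γ : ℝ} (hδ : Fintype.card K * (Fintype.card ι + Fintype.card J) * δ ≤ γ / 2)
    (hZ0 : 0 < #Z) (hτ0 : 0 ≤ τ) (hZ : 2 ^ Fintype.card J * τ ≤ δ * #Z)
    (hτ : ∀ k, τ ≤ c ^ Fintype.card J * (c ^ Fintype.card ι * a k))
    (hbad : ∀ k i, (#{s ∈ Fintype.piFinset (fun _ : S k => Z) | BadAt G R c (a k) i T s} : ℝ) ≤
      δ * (#Z : ℝ) ^ #(S k))
    (hγ : γ * (#Z : ℝ) ^ Fintype.card J ≤
      #{y ∈ Fintype.piFinset (fun _ : J => Z) | Independent R y}) :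
    γ / 2 * (#Z : ℝ) ^ Fintype.card J ≤
      #{y ∈ Fintype.piFinset (fun _ : J => Z) | Independent R y ∧
        ∀ k, (∀ i, ¬ BadAt G R c (a k) i T (fun j : S k => y j)) ∧
          ∀ j ∉ S k, ¬ HeavyAt R c (freeSet R (commonNbrs G (fun j : S k => y j)) T univ)
            (c ^ Fintype.card ι * a k) (S k)ᶜ j y} := by
  set E₁ : K → ι → Finset (J → V) := fun k i =>
    {y ∈ Fintype.piFinset (fun _ : J => Z) | BadAt G R c (a k) i T (fun j : S k => y j)} with hE₁
  set E₂ : K → J → Finset (J → V) := fun k j =>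
    {y ∈ Fintype.piFinset (fun _ : J => Z) | j ∉ S k ∧
      HeavyAt R c (freeSet R (commonNbrs G (fun j : S k => y j)) T univ)
            (c ^ Fintype.card ι * a k) (S k)ᶜ j y} with hE₂
  have hZ0' : (0 : ℝ) < #Z := by exact_mod_cast hZ0
  have h₁ : ∀ k i, (#(E₁ k i) : ℝ) ≤ δ * (#Z : ℝ) ^ Fintype.card J := fun k i =>
    card_filter_restrict_le Z (S k) _ (hbad k i)
  have h₂ : ∀ k j, (#(E₂ k j) : ℝ) ≤ δ * (#Z : ℝ) ^ Fintype.card J := by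
    intro k j
    have h3 := card_mul_card_filter_piFinset_le Z j (fun y : J → V => j ∉ S k ∧
      HeavyAt R c (freeSet R (commonNbrs G (fun j : S k => y j)) T univ)
            (c ^ Fintype.card ι * a k) (S k)ᶜ j y) (2 ^ Fintype.card J * τ) ?_
    · refine le_of_mul_le_mul_left (le_trans (le_of_eq ?_) (h3.trans ?_)) hZ0'
      · simp only [hE₂]
        congr!
      calc _ ≤ δ * #Z * (#Z : ℝ) ^ Fintype.card J := by gcongr
        _ = _ := by ring
    · intro y
      by_cases hj : j ∈ S k
      · simp only [hj, not_true_eq_false, false_and, filter_false, card_empty, Nat.cast_zero]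
        positivity
      -- The set in which `y j` must not be heavy depends only on the entries in `S k`, so
      -- resampling `j ∉ S k` leaves it fixed.
      have h4 : ∀ v, (fun j' : S k => update y j v j') = fun j' : S k => y j' := by
        intro v
        funext j'
        rw [update_of_ne]
        rintro rfl
        exact hj j'.2
      have hle : #(S k)ᶜ ≤ Fintype.card J := card_le_univ _
      have h5 := card_heavyAt_update_le hR hc hc1
        (freeSet R (commonNbrs G (fun j : S k => y j)) T univ)
        (a := c ^ Fintype.card ι * a k) (mul_nonneg (by positivity) (ha k)) (S k)ᶜ
        ((hτ k).trans (mul_le_mul_of_nonneg_right (pow_le_pow_of_le_one hc.le hc1 hle)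
          (mul_nonneg (by positivity) (ha k)))) j y
      refine le_trans ?_ (h5.trans ?_)
      · refine Nat.cast_le.2 (card_le_card fun v hv => ?_)
        simp only [mem_filter, mem_univ, true_and, h4] at hv ⊢
        exact hv.2.2
      · gcongr
        norm_num
  have hcover : ({y ∈ Fintype.piFinset (fun _ : J => Z) | Independent R y} :
      Finset (J → V)) ⊆
      {y ∈ Fintype.piFinset (fun _ : J => Z) | Independent R y ∧
        ∀ k, (∀ i, ¬ BadAt G R c (a k) i T (fun j : S k => y j)) ∧
          ∀ j ∉ S k, ¬ HeavyAt R c (freeSet R (commonNbrs G (fun j : S k => y j)) T univ)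
            (c ^ Fintype.card ι * a k) (S k)ᶜ j y} ∪
      (((univ : Finset K).biUnion fun k => univ.biUnion (E₁ k)) ∪
        ((univ : Finset K).biUnion fun k => univ.biUnion (E₂ k))) := by
    intro y hy
    obtain ⟨hyZ, hyR⟩ := mem_filter.1 hy
    by_contra hcon
    simp only [mem_union, mem_filter, mem_biUnion, mem_univ, true_and, hE₁, hE₂, not_or,
      not_exists, not_and] at hcon
    exact hcon.1 hyZ hyR fun k => ⟨fun i => hcon.2.1 k i hyZ, fun j => hcon.2.2 k j hyZ⟩
  have hsum₁ : (#((univ : Finset K).biUnion fun k => univ.biUnion (E₁ k)) : ℝ) ≤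
      Fintype.card K * (Fintype.card ι * (δ * (#Z : ℝ) ^ Fintype.card J)) := by
    calc _ ≤ ∑ k, ∑ i, (#(E₁ k i) : ℝ) := by
          exact_mod_cast card_biUnion_le.trans (sum_le_sum fun k _ => card_biUnion_le)
      _ ≤ ∑ _k : K, ∑ _i : ι, δ * (#Z : ℝ) ^ Fintype.card J :=
          sum_le_sum fun k _ => sum_le_sum fun i _ => h₁ k i
      _ = _ := by simp
  have hsum₂ : (#((univ : Finset K).biUnion fun k => univ.biUnion (E₂ k)) : ℝ) ≤
      Fintype.card K * (Fintype.card J * (δ * (#Z : ℝ) ^ Fintype.card J)) := by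
    calc _ ≤ ∑ k, ∑ j, (#(E₂ k j) : ℝ) := by
          exact_mod_cast card_biUnion_le.trans (sum_le_sum fun k _ => card_biUnion_le)
      _ ≤ ∑ _k : K, ∑ _j : J, δ * (#Z : ℝ) ^ Fintype.card J :=
          sum_le_sum fun k _ => sum_le_sum fun j _ => h₂ k j
      _ = _ := by simp
  have htot := hγ.trans (Nat.cast_le.2 ((card_le_card hcover).trans ((card_union_le _ _).trans
    (Nat.add_le_add_left (card_union_le _ _) _))))
  push_cast at htot
  have h6 : Fintype.card K * (Fintype.card ι + Fintype.card J) * δ * (#Z : ℝ) ^ Fintype.card J ≤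
      γ / 2 * (#Z : ℝ) ^ Fintype.card J := by gcongr
  linarith

-- `card_freeSet_of_not_heavyAt` is used twice: for the entries of `T`, then for those of `y`
-- outside `S`. Some index in `ι` is needed to read the size of the common neighbourhood off
-- `BadAt`.
open Classical in
theorem card_extension_ge {V ι J : Type*} [Fintype V] [Fintype ι] [Fintype J] [Nonempty ι]
    {G : SimpleGraph V} {R : V → V → Prop} {c : ℝ} (hc : 0 < c) (hc1 : c ≤ 1)
    (S : Finset J) {a : ℝ} (ha : 0 ≤ a) (T : ι → V) (y : J → V)
    (h1 : ∀ i, ¬ BadAt G R c a i T (fun j : S => y j))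
    (h2 : ∀ j ∉ S, ¬ HeavyAt R c (freeSet R (commonNbrs G (fun j : S => y j)) T univ)
            (c ^ Fintype.card ι * a) Sᶜ j y) :
    c ^ Fintype.card J * (c ^ Fintype.card ι * a) ≤
      #(freeSet R (freeSet R (commonNbrs G (fun j : S => y j)) T univ) y Sᶜ) := by
  obtain ⟨i₀⟩ := ‹Nonempty ι›
  have h3 : a ≤ #(commonNbrs G (fun j : S => y j)) := not_lt.1 fun h => h1 i₀ (Or.inl h)
  have h4 := card_freeSet_of_not_heavyAt (A := univ) hc h3 fun i _ h => h1 i (Or.inr h)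
  rw [card_univ] at h4
  refine le_trans ?_ (card_freeSet_of_not_heavyAt hc h4 fun j hj => h2 j (mem_compl.1 hj))
  have hle : #Sᶜ ≤ Fintype.card J := card_le_univ _
  exact mul_le_mul_of_nonneg_right (pow_le_pow_of_le_one hc.le hc1 hle) (by positivity)

/-! ### The weight of good tuples -/

-- Count independent tuples inside each neighbourhood. Degrees below `M * τ`, at most half the
-- average degree, account for at most half of the power sum, by the power mean inequality.
open Classical in
theorem sum_independent_ge {V ι : Type*} [Fintype V] [Fintype ι] [Nonempty ι] {G : SimpleGraph V}
    {R : V → V → Prop} {τ q M γ : ℝ} (hq0 : 0 ≤ q) (hn : 0 < Fintype.card V)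
    (hq : q * (Fintype.card V : ℝ) ^ 2 = ∑ v, (G.degree v : ℝ)) (hM : 0 ≤ M * τ)
    (hγ : 0 ≤ γ) (hτ : 2 * (M * τ) ≤ q * Fintype.card V)
    (H : ∀ Z : ι → Finset V, (∀ i, M * τ ≤ #(Z i)) →
      γ * ∏ i, (#(Z i) : ℝ) ≤
        #{z ∈ Fintype.piFinset Z | Independent R z}) :
    γ / 2 * ∑ v, (G.degree v : ℝ) ^ Fintype.card ι ≤
      ∑ T : ι → V with Independent R T, (#(commonNbrs G T) : ℝ) := by
  rw [sum_filter_card_commonNbrs]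
  have h1 : ∀ v, γ * (G.degree v : ℝ) ^ Fintype.card ι ≤
      (#{T ∈ Fintype.piFinset (fun _ : ι => G.neighborFinset v) |
        Independent R T} : ℝ) + γ * (M * τ) ^ Fintype.card ι := by
    intro v
    rcases le_or_gt (M * τ) (G.degree v) with h | h
    · have h2 := H (fun _ => G.neighborFinset v) (fun _ => by simpa using h)
      simp only [SimpleGraph.card_neighborFinset_eq_degree, prod_const, card_univ] at h2
      have : 0 ≤ γ * (M * τ) ^ Fintype.card ι := by positivity
      linarith
    · have : γ * (G.degree v : ℝ) ^ Fintype.card ι ≤ γ * (M * τ) ^ Fintype.card ι := by gcongr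
      exact this.trans (le_add_of_nonneg_left (Nat.cast_nonneg _))
  have h2 := sum_le_sum fun v (_ : v ∈ univ) => h1 v
  rw [← mul_sum, sum_add_distrib, sum_const, nsmul_eq_mul, card_univ] at h2
  have h3 := pow_le_sum_degree_pow G q hq0 (Fintype.card ι) hn hq
  have h4 : (Fintype.card V : ℝ) * (M * τ) ^ Fintype.card ι ≤
      (∑ v, (G.degree v : ℝ) ^ Fintype.card ι) / 2 := by
    obtain ⟨l, hl⟩ : ∃ l, Fintype.card ι = l + 1 :=
      ⟨_, (Nat.sub_add_cancel Fintype.card_pos).symm⟩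
    rw [hl] at h3 ⊢
    have h5 : (2 * (M * τ)) ^ (l + 1) ≤ (q * Fintype.card V) ^ (l + 1) := by gcongr
    have h6 : 2 * (M * τ) ^ (l + 1) ≤ (2 * (M * τ)) ^ (l + 1) := by
      rw [mul_pow 2]
      gcongr
      calc (2 : ℝ) = 2 ^ 1 := by norm_num
        _ ≤ 2 ^ (l + 1) := pow_le_pow_right₀ (by norm_num) (by omega)
    have h7 : (Fintype.card V : ℝ) * (2 * (M * τ) ^ (l + 1)) ≤
        Fintype.card V * (q * Fintype.card V) ^ (l + 1) := by
      gcongr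
      exact h6.trans h5
    have h8 : (Fintype.card V : ℝ) * (q * Fintype.card V) ^ (l + 1) =
        q ^ (l + 1) * (Fintype.card V : ℝ) ^ (l + 1 + 1) := by ring
    linarith
  have h9 := mul_le_mul_of_nonneg_left h4 hγ
  linarith

open Classical in
theorem sum_filter_le_add_add {α β : Type*} [Fintype α] [Fintype β] (w : α → ℝ)
    (hw : ∀ x, 0 ≤ w x) (p r : α → Prop) (b : β → α → Prop) :
    ∑ x with p x, w x ≤ ∑ x with p x ∧ r x ∧ ∀ k, ¬ b k x, w x + ∑ x with ¬ r x, w x +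
      ∑ k, ∑ x with b k x, w x := by
  simp only [sum_filter]
  rw [sum_comm, ← sum_add_distrib, ← sum_add_distrib]
  refine sum_le_sum fun x _ => ?_
  have h0 : ∀ k, 0 ≤ if b k x then w x else 0 := fun k => by split_ifs <;> simp [hw]
  have h1 : 0 ≤ ∑ k, if b k x then w x else 0 := sum_nonneg fun k _ => h0 k
  by_cases hb : ∀ k, ¬ b k x
  · have := hw x
    by_cases hp : p x <;> by_cases hr : r x <;> simp [hp, hr, hb, this]
  · push Not at hb
    obtain ⟨k, hk⟩ := hb
    have h2 := single_le_sum (fun k _ => h0 k) (mem_univ k)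
    rw [if_pos hk] at h2
    have := hw x
    split_ifs <;> linarith

open Classical in
/-- The independent tuples with a large common neighbourhood, few of whose subtuples are bad, carry
a positive proportion of the total weight. -/
theorem sum_good_ge {V ι J K : Type*} [Fintype V] [Fintype ι] [Fintype K]
    {G : SimpleGraph V} {R : V → V → Prop} {c q ε δ κ θ : ℝ} {d : ℕ} (S : K → Finset J)
    (hS : ∀ k, #(S k) ≤ d)
    (hq0 : 0 < q) (hn : 0 < Fintype.card V)
    (hq : q * (Fintype.card V : ℝ) ^ 2 = ∑ v, (G.degree v : ℝ))
    (hδ : 0 < δ) (hκ : 0 < κ) (hκ1 : κ ≤ 1) (hε : 0 ≤ ε) (hθ : 0 ≤ θ)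
    (hκθ : Fintype.card K * Fintype.card ι * κ ≤ θ)
    (hεθ : Fintype.card K * Fintype.card ι * (ε / (δ * κ ^ d)) ≤ θ)
    (hP : ∀ k i (T : ι → V) (s : S k → V), (#{x ∈ commonNbrs G s |
      BadAt G R c (ε * q ^ #(S k) * Fintype.card V) i (update T i x) s} : ℝ) ≤
      ε * q ^ max #(S k) 1 * Fintype.card V)
    (hind : 4 * θ * ∑ v, (G.degree v : ℝ) ^ Fintype.card ι ≤
      ∑ T : ι → V with Independent R T, (#(commonNbrs G T) : ℝ)) :
    θ * ∑ v, (G.degree v : ℝ) ^ Fintype.card ι ≤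
      ∑ T : ι → V with Independent R T ∧
        θ * (q ^ Fintype.card ι * Fintype.card V) ≤ #(commonNbrs G T) ∧
        ∀ k i, (#{s ∈ Fintype.piFinset (fun _ : S k => commonNbrs G T) |
          BadAt G R c (ε * q ^ #(S k) * Fintype.card V) i T s} : ℝ) ≤
            δ * (#(commonNbrs G T) : ℝ) ^ #(S k), (#(commonNbrs G T) : ℝ) := by
  have hD : q ^ Fintype.card ι * (Fintype.card V : ℝ) ^ (Fintype.card ι + 1) ≤
      ∑ v, (G.degree v : ℝ) ^ Fintype.card ι := pow_le_sum_degree_pow G q hq0.le _ hn hq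
  have hD0 : 0 ≤ ∑ v, (G.degree v : ℝ) ^ Fintype.card ι := sum_nonneg fun _ _ => by positivity
  have hbadsum : ∀ k i, ∑ T : ι → V with δ * (#(commonNbrs G T) : ℝ) ^ #(S k) <
      (#{s ∈ Fintype.piFinset (fun _ : S k => commonNbrs G T) |
          BadAt G R c (ε * q ^ #(S k) * Fintype.card V) i T s} : ℝ), (#(commonNbrs G T) : ℝ) ≤
      (κ + ε / (δ * κ ^ d)) * ∑ v, (G.degree v : ℝ) ^ Fintype.card ι := by
    intro k i
    have h1 := sum_bad_le (σ := S k) G hq0 hn hq i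
      (fun T s => BadAt G R c (ε * q ^ #(S k) * Fintype.card V) i T s) hδ hκ hκ1 hε
      (by simpa using hP k i)
    rw [Fintype.card_coe] at h1
    refine le_trans (le_of_eq (by congr!)) (h1.trans (mul_le_mul_of_nonneg_right ?_ hD0))
    clear hP hind h1 hD hD0 hq
    have : κ ^ d ≤ κ ^ #(S k) := pow_le_pow_of_le_one hκ.le hκ1 (hS k)
    gcongr
  generalize (∑ v, (G.degree v : ℝ) ^ Fintype.card ι) = D at *
  have hlowsum : ∑ T : ι → V with ¬ θ * (q ^ Fintype.card ι * Fintype.card V) ≤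
      #(commonNbrs G T), (#(commonNbrs G T) : ℝ) ≤ θ * D := by
    calc _ ≤ ∑ T : ι → V with ¬ θ * (q ^ Fintype.card ι * Fintype.card V) ≤
            #(commonNbrs G T), θ * (q ^ Fintype.card ι * Fintype.card V) :=
          sum_le_sum fun T hT => (not_le.1 (mem_filter.1 hT).2).le
      _ ≤ ∑ T : ι → V, θ * (q ^ Fintype.card ι * Fintype.card V) :=
          sum_le_sum_of_subset_of_nonneg (subset_univ _) fun _ _ _ => by positivity
      _ = θ * (q ^ Fintype.card ι * (Fintype.card V : ℝ) ^ (Fintype.card ι + 1)) := by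
          rw [sum_const, nsmul_eq_mul, card_univ, Fintype.card_fun]
          push_cast
          ring
      _ ≤ θ * D := by gcongr
  have h1 := sum_filter_le_add_add (fun T : ι → V => (#(commonNbrs G T) : ℝ))
    (fun T => Nat.cast_nonneg _) (Independent R)
    (fun T => θ * (q ^ Fintype.card ι * Fintype.card V) ≤ #(commonNbrs G T))
    (fun (p : K × ι) T => δ * (#(commonNbrs G T) : ℝ) ^ #(S p.1) <
      (#{s ∈ Fintype.piFinset (fun _ : S p.1 => commonNbrs G T) |
          BadAt G R c (ε * q ^ #(S p.1) * Fintype.card V) p.2 T s} : ℝ))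
  have h2 := sum_le_sum fun (p : K × ι) (_ : p ∈ univ) => hbadsum p.1 p.2
  rw [sum_const, nsmul_eq_mul, card_univ, Fintype.card_prod] at h2
  push_cast at h2
  have h3 := mul_le_mul_of_nonneg_right (add_le_add hκθ hεθ) hD0
  simp only [not_lt, Prod.forall] at h1
  have h4 := sub_le_iff_le_add.2 (sub_le_iff_le_add.2 (hind.trans h1))
  -- Of `4 * θ * D`, the bad tuples remove at most `2 * θ * D` (the `κ` and `ε` terms) and the small
  -- common neighbourhoods `θ * D`.
  have h5 := sub_le_sub (sub_le_sub_left h2 (4 * θ * D)) hlowsum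
  refine le_trans ?_ (h5.trans (h4.trans (le_of_eq (by congr!))))
  linarith

/-! ### Counting good triples -/

/-- `(x, y, z)` is a copy in `G`, with no further `R`-related pairs inside a part or between `x` and
`z` or between `y` and `z`, of the graph in which `x` is complete to `y` and `z k` is joined to the
`y j` with `j ∈ S k`. -/
structure IsGoodTriple {V ι J K : Type*} (G : SimpleGraph V) (R : V → V → Prop) (S : K → Finset J)
    (x : ι → V) (y : J → V) (z : K → V) : Prop where
  indep_x : Independent R x
  indep_y : Independent R y
  indep_z : Independent R z
  adj_xy : ∀ i j, G.Adj (x i) (y j)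
  adj_yz : ∀ k, ∀ j ∈ S k, G.Adj (y j) (z k)
  free_yz : ∀ k, ∀ j ∉ S k, ¬ R (y j) (z k)
  free_xz : ∀ i k, ¬ R (x i) (z k)

open Classical in
theorem card_isGoodTriple_ge {V ι J K : Type*} [Fintype V] [Fintype ι] [Fintype J] [Fintype K]
    {G : SimpleGraph V} {R : V → V → Prop} {S : K → Finset J} (𝒯 : Finset (ι → V))
    (𝒴 : (ι → V) → Finset (J → V)) (Z : (ι → V) → (J → V) → K → Finset V) {N Y : ℝ}
    (h𝒯 : ∀ x ∈ 𝒯, Independent R x)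
    (h𝒴 : ∀ x ∈ 𝒯, ∀ y ∈ 𝒴 x, Independent R y ∧ ∀ j, y j ∈ commonNbrs G x)
    (hZ : ∀ x y k, Z x y k = freeSet R (freeSet R (commonNbrs G (fun j : S k => y j)) x univ) y
      (S k)ᶜ)
    (hN : ∀ x ∈ 𝒯, ∀ y ∈ 𝒴 x,
      N ≤ #{z ∈ Fintype.piFinset (Z x y) | Independent R z})
    (hN0 : 0 ≤ N) (hY : Y ≤ ∑ x ∈ 𝒯, (#(𝒴 x) : ℝ)) :
    Y * N ≤ #{p : (ι → V) × (J → V) × (K → V) | IsGoodTriple G R S p.1 p.2.1 p.2.2} := by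
  have h1 : #(𝒯.sigma fun x => (𝒴 x).sigma fun y =>
      ({z ∈ Fintype.piFinset (Z x y) | Independent R z} : Finset (K → V))) ≤
      #{p : (ι → V) × (J → V) × (K → V) | IsGoodTriple G R S p.1 p.2.1 p.2.2} := by
    refine card_le_card_of_injOn (fun p => (p.1, p.2.1, p.2.2)) ?_ ?_
    · rintro ⟨x, y, z⟩ hp
      simp only [coe_sigma, Set.mem_sigma_iff, mem_coe, mem_filter, Fintype.mem_piFinset] at hp
      obtain ⟨hx, hy, hz, hzR⟩ := hp
      simp only [hZ, freeSet, mem_filter, mem_compl, mem_univ, true_implies, mem_commonNbrs] at hz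
      obtain ⟨hyR, hyx⟩ := h𝒴 x hx y hy
      simp only [mem_commonNbrs] at hyx
      simp only [coe_filter, Set.mem_ofPred_eq, mem_univ, true_and]
      exact ⟨h𝒯 x hx, hyR, hzR, fun i j => hyx j i, fun k j hj => (hz k).1.1 ⟨j, hj⟩,
        fun k j hj => (hz k).2 j hj, fun i k => (hz k).1.2 i⟩
    · rintro ⟨x, y, z⟩ _ ⟨x', y', z'⟩ _ h
      simp only [Prod.mk.injEq] at h
      obtain ⟨rfl, rfl, rfl⟩ := h
      rfl
  refine le_trans ?_ (Nat.cast_le.2 h1)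
  rw [card_sigma, Nat.cast_sum]
  calc Y * N ≤ (∑ x ∈ 𝒯, (#(𝒴 x) : ℝ)) * N := by gcongr
    _ = ∑ x ∈ 𝒯, ∑ y ∈ 𝒴 x, N := by
      rw [sum_mul]
      exact sum_congr rfl fun x _ => by rw [sum_const, nsmul_eq_mul]
    _ ≤ _ := sum_le_sum fun x hx => by
      rw [card_sigma, Nat.cast_sum]
      exact sum_le_sum fun y hy => hN x hx y hy

open Classical in
theorem exists_card_isGoodTriple_ge (ι J K : Type*) [Fintype ι] [Fintype J] [Fintype K]
    [Nonempty ι] [Nonempty J] (S : K → Finset J) (d : ℕ) (hι : Fintype.card ι ≤ d)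
    (hS : ∀ k, #(S k) ≤ d) (c : ℝ) (hc : 0 < c) (hc1 : c ≤ 1) :
    ∃ M α : ℝ, 0 < M ∧ 0 < α ∧ ∀ (V : Type*) [Fintype V] (G : SimpleGraph V) (R : V → V → Prop)
      (τ q : ℝ), (∀ x y, R x y → R y x) → 0 ≤ τ → SparseRel R c τ → 0 < q → q ≤ 1 →
      0 < Fintype.card V → q * (Fintype.card V : ℝ) ^ 2 = ∑ v, (G.degree v : ℝ) →
      M * τ ≤ q ^ d * Fintype.card V →
      α * q ^ (Fintype.card ι * Fintype.card J + ∑ k, #(S k)) *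
        (Fintype.card V : ℝ) ^ (Fintype.card ι + Fintype.card J + Fintype.card K) ≤
        #{p : (ι → V) × (J → V) × (K → V) | IsGoodTriple G R S p.1 p.2.1 p.2.2} := by
  obtain ⟨M₁, γ₁, hM₁, hγ₁, H₁⟩ := exists_card_independent c hc ι
  obtain ⟨M₂, γ₂, hM₂, hγ₂, H₂⟩ := exists_card_independent c hc J
  obtain ⟨M₃, γ₃, hM₃, hγ₃, H₃⟩ := exists_card_independent c hc K
  set l := Fintype.card ι with hl
  set b := Fintype.card J with hb
  set m := Fintype.card K with hm
  have hl0 : 0 < l := Fintype.card_pos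
  have hb0 : 0 < b := Fintype.card_pos
  -- The order matters: `κ` depends on `θ`, and `ε` must be small against `δ * κ ^ d`.
  obtain ⟨θ, hθ, hθγ⟩ : ∃ θ : ℝ, 0 < θ ∧ 4 * θ = γ₁ / 2 := ⟨γ₁ / 8, by positivity, by ring⟩
  obtain ⟨δ, hδ, hδγ⟩ : ∃ δ : ℝ, 0 < δ ∧ m * (l + b) * δ ≤ γ₂ / 2 := by
    refine ⟨γ₂ / 2 / (m * (l + b) + 1), by positivity, ?_⟩
    rw [mul_div_assoc', div_le_iff₀ (by positivity)]
    have : 0 < γ₂ / 2 := by positivity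
    linarith
  obtain ⟨κ, hκ, hκ1, hκθ⟩ : ∃ κ : ℝ, 0 < κ ∧ κ ≤ 1 ∧ m * l * κ ≤ θ := by
    refine ⟨min 1 (θ / (m * l + 1)), by positivity, min_le_left _ _, ?_⟩
    calc (m * l * min 1 (θ / (m * l + 1)) : ℝ) ≤ m * l * (θ / (m * l + 1)) := by
          gcongr; exact min_le_right _ _
      _ ≤ θ := by
          rw [mul_div_assoc', div_le_iff₀ (by positivity)]
          linarith
  obtain ⟨ε, hε, hε1, hεθ⟩ : ∃ ε : ℝ, 0 < ε ∧ ε ≤ 1 ∧ m * l * (ε / (δ * κ ^ d)) ≤ θ := by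
    refine ⟨min 1 (θ * (δ * κ ^ d) / (m * l + 1)), by positivity, min_le_left _ _, ?_⟩
    calc (m * l * (min 1 (θ * (δ * κ ^ d) / (m * l + 1)) / (δ * κ ^ d)) : ℝ)
        ≤ m * l * (θ * (δ * κ ^ d) / (m * l + 1) / (δ * κ ^ d)) := by
          gcongr; exact min_le_right _ _
      _ = m * l * θ / (m * l + 1) := by field_simp
      _ ≤ θ := by
          rw [div_le_iff₀ (by positivity)]
          linarith
  -- The share left of an extension set after avoiding the `l` entries of `x` and at most `b`
  -- entries of `y`.
  set η : ℝ := c ^ b * (c ^ l * ε) with hη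
  have hη0 : 0 < η := by positivity
  -- Each summand of `M` serves one of the smallness conditions `f1` to `f6` on `τ`.
  refine ⟨2 * M₁ + 2 ^ l / ε + 1 / η + M₂ / θ + 2 ^ b / (δ * θ) + M₃ / η,
    γ₂ / 2 * θ ^ b * (γ₃ * η ^ m), by positivity, by positivity, ?_⟩
  intro V _ G R τ q hsymm hτ hR hq0 hq1 hn hq hM
  have hn' : (0 : ℝ) < Fintype.card V := by exact_mod_cast hn
  have hqs : ∀ s ≤ d, q ^ d * Fintype.card V ≤ q ^ s * Fintype.card V := fun s hs =>
    mul_le_mul_of_nonneg_right (pow_le_pow_of_le_one hq0.le hq1 hs) hn'.le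
  have hMs : ∀ A s, s ≤ d →
      A ≤ 2 * M₁ + 2 ^ l / ε + 1 / η + M₂ / θ + 2 ^ b / (δ * θ) + M₃ / η →
      A * τ ≤ q ^ s * Fintype.card V := fun A s hs hA =>
    (mul_le_mul_of_nonneg_right hA hτ).trans (hM.trans (hqs s hs))
  have e1 : 0 ≤ 2 ^ l / ε := by positivity
  have e2 : 0 ≤ 1 / η := by positivity
  have e3 : 0 ≤ M₂ / θ := by positivity
  have e4 : 0 ≤ 2 ^ b / (δ * θ) := by positivity
  have e5 : 0 ≤ M₃ / η := by positivity
  have f1 : 2 * M₁ * τ ≤ q ^ 1 * Fintype.card V := hMs _ 1 (by omega) (by linarith)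
  have f2 : ∀ s ≤ d, 2 ^ l / ε * τ ≤ q ^ s * Fintype.card V := fun s hs =>
    hMs _ s hs (by linarith)
  have f3 : ∀ s ≤ d, 1 / η * τ ≤ q ^ s * Fintype.card V := fun s hs => hMs _ s hs (by linarith)
  have f4 : M₂ / θ * τ ≤ q ^ l * Fintype.card V := hMs _ l hι (by linarith)
  have f5 : 2 ^ b / (δ * θ) * τ ≤ q ^ l * Fintype.card V := hMs _ l hι (by linarith)
  have f6 : ∀ s ≤ d, M₃ / η * τ ≤ q ^ s * Fintype.card V := fun s hs => hMs _ s hs (by linarith)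
  clear hMs e1 e2 e3 e4 e5 hM
  simp only [div_mul_eq_mul_div, div_le_iff₀ hε, div_le_iff₀ hη0, div_le_iff₀ hθ,
    div_le_iff₀ (mul_pos hδ hθ), one_mul] at f2 f3 f4 f5 f6
  have g3 : ∀ k, τ ≤ c ^ b * (c ^ l * (ε * q ^ #(S k) * Fintype.card V)) := fun k =>
    (f3 _ (hS k)).trans (le_of_eq (by rw [hη]; ring))
  have g3' : ∀ k, τ ≤ c ^ l * (ε * q ^ #(S k) * Fintype.card V) := fun k =>
    (g3 k).trans (mul_le_of_le_one_left (by positivity) (pow_le_one₀ hc.le hc1))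
  have hind := sum_independent_ge (ι := ι) (R := R) (τ := τ) (M := M₁) hq0.le hn hq
    (by positivity) hγ₁.le (by linarith) (H₁ V R τ hsymm hτ hR)
  rw [← hθγ] at hind
  have hgood := sum_good_ge (c := c) (d := d) S hS hq0 hn hq hδ hκ hκ1 hε.le hθ.le hκθ hεθ
    (fun k i T s => by
      have := card_badAt_update_le (G := G) (σ := S k) hR hc hc1 hq0 hε hε1
        (by simpa using g3' k)
        (by
          have := f2 (max #(S k) 1) (max_le (hS k) (by omega))
          rw [Fintype.card_coe]
          linarith) i T s
      rw [Fintype.card_coe] at this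
      exact le_trans (le_of_eq (by congr!)) this) hind
  set 𝒯 : Finset (ι → V) := {T : ι → V | Independent R T ∧
        θ * (q ^ Fintype.card ι * Fintype.card V) ≤ #(commonNbrs G T) ∧
        ∀ k i, (#{s ∈ Fintype.piFinset (fun _ : S k => commonNbrs G T) |
          BadAt G R c (ε * q ^ #(S k) * Fintype.card V) i T s} : ℝ) ≤
            δ * (#(commonNbrs G T) : ℝ) ^ #(S k)} with h𝒯
  set 𝒴 : (ι → V) → Finset (J → V) := fun T =>
    {y ∈ Fintype.piFinset (fun _ : J => commonNbrs G T) | Independent R y ∧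
        ∀ k, (∀ i, ¬ BadAt G R c (ε * q ^ #(S k) * Fintype.card V) i T (fun j : S k => y j)) ∧
          ∀ j ∉ S k, ¬ HeavyAt R c (freeSet R (commonNbrs G (fun j : S k => y j)) T univ)
            (c ^ l * (ε * q ^ #(S k) * Fintype.card V)) (S k)ᶜ j y} with h𝒴
  have h𝒴card : ∀ T ∈ 𝒯, γ₂ / 2 * (#(commonNbrs G T) : ℝ) ^ b ≤ #(𝒴 T) := by
    intro T hT
    obtain ⟨-, hT2, hT3⟩ := (mem_filter.1 hT).2
    have hw : (0 : ℝ) < #(commonNbrs G T) := lt_of_lt_of_le (by positivity) hT2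
    refine le_trans (card_good_extension_ge (G := G) hR hc hc1 S
      (fun k => ε * q ^ #(S k) * Fintype.card V) (fun k => by positivity) T (commonNbrs G T)
      hδγ (by exact_mod_cast hw) hτ ?_ g3 ?_ ?_) (le_of_eq ?_)
    · calc 2 ^ b * τ ≤ q ^ l * Fintype.card V * (δ * θ) := f5
        _ = δ * (θ * (q ^ l * Fintype.card V)) := by ring
        _ ≤ δ * #(commonNbrs G T) := by gcongr
    · intro k i
      exact hT3 k i
    · have h1 := H₂ V R τ hsymm hτ hR (fun _ => commonNbrs G T) fun _ => by
        linarith [f4.trans_eq (mul_comm _ _)]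
      rw [prod_const, card_univ] at h1
      exact h1
    · simp only [h𝒴]
      congr!
  -- One factor `#(commonNbrs G T)` is kept, to be summed by `hgood`; the other `b - 1` are replaced
  -- by their lower bound.
  have hw𝒯 : ∀ T ∈ 𝒯, γ₂ / 2 * (θ * (q ^ l * Fintype.card V)) ^ (b - 1) *
      #(commonNbrs G T) ≤ #(𝒴 T) := by
    intro T hT
    refine le_trans ?_ (h𝒴card T hT)
    have hT2 := (mem_filter.1 hT).2.2.1
    obtain ⟨r, hr⟩ : ∃ r, b = r + 1 := ⟨_, (Nat.sub_add_cancel hb0).symm⟩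
    rw [hr, Nat.add_sub_cancel, pow_succ, mul_assoc]
    refine mul_le_mul_of_nonneg_left (mul_le_mul_of_nonneg_right ?_ ?_) ?_
    · exact pow_le_pow_left₀ (by positivity) hT2 r
    · exact Nat.cast_nonneg _
    · positivity
  have hfin := card_isGoodTriple_ge (G := G) (R := R) (S := S) 𝒯 𝒴
    (fun x y k => freeSet R (freeSet R (commonNbrs G (fun j : S k => y j)) x univ) y (S k)ᶜ)
    (N := γ₃ * ∏ k, (η * q ^ #(S k) * Fintype.card V))
    (Y := γ₂ / 2 * (θ * (q ^ l * Fintype.card V)) ^ (b - 1) *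
      (θ * (q ^ l * (Fintype.card V : ℝ) ^ (l + 1))))
    (fun T hT => (mem_filter.1 hT).2.1)
    (fun T _ y hy => ⟨(mem_filter.1 hy).2.1, Fintype.mem_piFinset.1 (mem_filter.1 hy).1⟩)
    (fun _ _ _ => rfl) ?_ (by positivity) ?_
  · refine le_trans (le_of_eq ?_) hfin
    rw [prod_mul_distrib, prod_mul_distrib, prod_pow_eq_pow_sum, prod_const, prod_const,
      card_univ, ← hm]
    obtain ⟨r, hr⟩ : ∃ r, b = r + 1 := ⟨_, (Nat.sub_add_cancel hb0).symm⟩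
    rw [hr, Nat.add_sub_cancel]
    ring
  · intro T hT y hy
    have hext : ∀ k, η * q ^ #(S k) * Fintype.card V ≤ #(freeSet R (freeSet R
        (commonNbrs G (fun j : S k => y j)) T univ) y (S k)ᶜ) := by
      intro k
      have h1 := (mem_filter.1 hy).2.2 k
      refine le_trans (le_of_eq ?_) (card_extension_ge hc hc1 (S k)
        (a := ε * q ^ #(S k) * Fintype.card V) (by positivity) T y h1.1 h1.2)
      rw [hη]
      ring
    refine le_trans ?_ (H₃ V R τ hsymm hτ hR _ fun k => le_trans ?_ (hext k))
    · gcongr with k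
      exact hext k
    · linarith [f6 _ (hS k)]
  · calc _ ≤ γ₂ / 2 * (θ * (q ^ l * Fintype.card V)) ^ (b - 1) *
          ∑ T ∈ 𝒯, (#(commonNbrs G T) : ℝ) := by
          refine mul_le_mul_of_nonneg_left (le_trans ?_ hgood) (by positivity)
          exact mul_le_mul_of_nonneg_left (pow_le_sum_degree_pow G q hq0.le _ hn hq) hθ.le
      _ ≤ _ := by
          rw [mul_sum]
          exact sum_le_sum hw𝒯

/-! ### From sparse graphs to sparse relations -/

-- More than `τ` exceptional vertices would span too many edges with `Y`. Since `R` may contain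
-- equality, `x` itself may be lost from `Y`; `1 / c'` in `τ` makes this loss at most `c' * #Y`,
-- whence `2 * c' ≤ c`.
open Classical in
theorem SimpleGraph.IsSparse.sparseRel {V : Type*} [Fintype V] {Γ : SimpleGraph V} {c t c' : ℝ}
    (h : Γ.IsSparse c t) (ht : 1 ≤ t) (hc' : 0 < c') (hcc : 2 * c' ≤ c) {R : V → V → Prop}
    (hR : ∀ x y, R x y → Γ.Adj x y ∨ x = y) :
    SparseRel R c' ((1 + 1 / c') * t) := by
  intro Y hY
  set X : Finset V := {x : V | (#{y ∈ Y | ¬ R x y} : ℝ) < c' * #Y} with hX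
  have hd : 0 ≤ 1 / c' := by positivity
  have ht1 : t ≤ (1 + 1 / c') * t := by nlinarith
  by_contra hXc
  rw [not_le] at hXc
  have hs := h X Y (ht1.trans hXc.le) (ht1.trans hY)
  have hY1 : 1 ≤ c' * #Y := by
    have h1 : 1 / c' ≤ #Y := by nlinarith
    rwa [div_le_iff₀ hc', mul_comm] at h1
  have hdeg : ∀ x ∈ X, (1 - c) * #Y < (#{y ∈ Y | Γ.Adj x y} : ℝ) := by
    intro x hx
    have h1 := (mem_filter.1 hx).2
    have h2 : (#Y : ℝ) ≤ #{y ∈ Y | Γ.Adj x y} + (#{y ∈ Y | ¬ R x y} + 1) := by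
      have h3 : Y ⊆ {y ∈ Y | Γ.Adj x y} ∪ ({y ∈ Y | ¬ R x y} ∪ {x}) := by
        intro y hy
        simp only [mem_union, mem_filter, mem_singleton, hy, true_and]
        have := hR x y
        tauto
      have h4 := (card_le_card h3).trans ((card_union_le _ _).trans
        (Nat.add_le_add_left (card_union_le _ _) _))
      rw [card_singleton] at h4
      exact_mod_cast h4
    nlinarith
  have hcard : (#(Γ.interedges X Y) : ℝ) = ∑ x ∈ X, (#{y ∈ Y | Γ.Adj x y} : ℝ) := by
    rw [SimpleGraph.interedges, Rel.interedges, card_filter, sum_product]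
    push_cast
    refine sum_congr rfl fun x _ => ?_
    rw [card_filter]
    push_cast
    rfl
  have hXne : X.Nonempty := by
    rw [← card_pos]
    have : (0 : ℝ) < #X := by linarith
    exact_mod_cast this
  have h5 := sum_lt_sum_of_nonempty hXne hdeg
  rw [sum_const, nsmul_eq_mul, ← hcard] at h5
  linarith

theorem SimpleGraph.IsSparse.eq_bot {V : Type*} [Fintype V] {Γ : SimpleGraph V} {c t : ℝ}
    (h : Γ.IsSparse c t) (hc : 0 < c) (ht : t ≤ 1) : Γ = ⊥ := by
  classical
  ext x y
  simp only [SimpleGraph.bot_adj, iff_false]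
  intro hxy
  have h1 := h {x} {y} (by simpa using ht) (by simpa using ht)
  have h2 : Γ.interedges {x} {y} = {(x, y)} := by
    ext ⟨a, b⟩
    simp only [SimpleGraph.mem_interedges_iff, mem_singleton, Prod.mk.injEq]
    constructor
    · rintro ⟨rfl, rfl, -⟩; exact ⟨rfl, rfl⟩
    · rintro ⟨rfl, rfl⟩; exact ⟨rfl, rfl, hxy⟩
  have h3 : (#(Γ.interedges {x} {y}) : ℝ) = 1 := by rw [h2]; simp
  rw [card_singleton, card_singleton, Nat.cast_one, mul_one, mul_one, h3] at h1
  linarith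

/-! ### Relation embeddings and induced copies -/

/-- The map `φ` sends edges of `H` to edges of `G`, and pairs of distinct non-adjacent vertices of
`H` to pairs not related by `R`. -/
def IsRelEmbedding {W V : Type*} (H : SimpleGraph W) (G : SimpleGraph V) (R : V → V → Prop)
    (φ : W → V) : Prop :=
  (∀ u v, H.Adj u v → G.Adj (φ u) (φ v)) ∧ ∀ u v, u ≠ v → ¬ H.Adj u v → ¬ R (φ u) (φ v)

-- As `R` contains equality, embeddings are injective and their images are induced copies. A copy
-- arises only from maps into its own `Fintype.card W` vertices.
open Classical in
theorem card_isRelEmbedding_le {W V : Type*} [Fintype W] [Fintype V] (H : SimpleGraph W)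
    (G Γ : SimpleGraph V) :
    #{φ : W → V | IsRelEmbedding H G (fun x y => Γ.Adj x y ∨ x = y) φ} ≤
      Fintype.card W ^ Fintype.card W * (H.inducedCopies G Γ).ncard := by
  have hinj : ∀ φ : W → V, IsRelEmbedding H G (fun x y => Γ.Adj x y ∨ x = y) φ →
      Injective φ := by
    intro φ hφ u v huv
    by_contra hne
    by_cases h : H.Adj u v
    · exact (hφ.1 u v h).ne huv
    · exact hφ.2 u v hne h (Or.inr huv)
  let sub : (W → V) → G.Subgraph := fun φ =>
    if hφ : IsRelEmbedding H G (fun x y => Γ.Adj x y ∨ x = y) φ then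
      (⟨⟨φ, fun {a b} => hφ.1 a b⟩, hinj φ hφ⟩ : SimpleGraph.Copy H G).toSubgraph else ⊥
  have hverts : ∀ φ, IsRelEmbedding H G (fun x y => Γ.Adj x y ∨ x = y) φ →
      (sub φ).verts = Set.range φ := by
    intro φ hφ
    simp only [sub, dif_pos hφ, SimpleGraph.Copy.toSubgraph, SimpleGraph.Subgraph.map_verts,
      SimpleGraph.Subgraph.verts_top, Set.image_univ]
    rfl
  have hcopy : ∀ φ, IsRelEmbedding H G (fun x y => Γ.Adj x y ∨ x = y) φ →
      sub φ ∈ H.inducedCopies G Γ := by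
    intro φ hφ
    refine ⟨?_, ?_⟩
    · have h : sub φ = _ := dif_pos hφ
      rw [h]
      exact ⟨SimpleGraph.Copy.isoToSubgraph _⟩
    · intro x hx y hy hxy
      rw [hverts φ hφ] at hx hy
      obtain ⟨u, rfl⟩ := hx
      obtain ⟨v, rfl⟩ := hy
      have huv : H.Adj u v := by
        by_contra hcon
        exact hφ.2 u v (fun h => hxy.ne (by rw [h])) hcon (Or.inl hxy)
      simp only [sub, dif_pos hφ, SimpleGraph.Copy.toSubgraph, SimpleGraph.Subgraph.map_adj]
      exact ⟨u, v, huv, rfl, rfl⟩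
  have hfin : (H.inducedCopies G Γ).Finite := Set.toFinite _
  rw [Set.ncard_eq_toFinset_card _ hfin]
  refine card_le_mul_card_image_of_maps_to (f := sub) (fun φ hφ => ?_) _ fun K hK => ?_
  · rw [Set.Finite.mem_toFinset]
    exact hcopy φ (mem_filter.1 hφ).2
  · obtain ⟨⟨e⟩, -⟩ := (Set.Finite.mem_toFinset _).1 hK
    have hKcard : Fintype.card K.verts = Fintype.card W := (Fintype.card_congr e.toEquiv).symm
    refine (card_le_card (t := Fintype.piFinset fun _ : W => K.verts.toFinset) ?_).trans
      (le_of_eq ?_)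
    · intro φ hφ
      obtain ⟨h1, rfl⟩ := mem_filter.1 hφ
      rw [Fintype.mem_piFinset]
      intro w
      rw [Set.mem_toFinset, hverts φ (mem_filter.1 h1).2]
      exact ⟨w, rfl⟩
    · rw [Fintype.card_piFinset, prod_const, card_univ, Set.toFinset_card, hKcard]

open Classical in
theorem SimpleGraph.IsDBounded.exists_finset {W : Type*} [Fintype W] {H : SimpleGraph W} {d : ℕ}
    (hH : H.IsDBounded d) :
    ∃ A₀ A₁ B : Finset W, Disjoint A₀ A₁ ∧ A₀ ∪ A₁ ∪ B = univ ∧ A₀.Nonempty ∧ #A₀ ≤ d ∧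
      H.IsBipartiteWith (A₀ ∪ A₁ : Finset W) B ∧ (∀ a ∈ A₀, ∀ b ∈ B, H.Adj a b) ∧
      ∀ a ∈ A₁, H.degree a ≤ d := by
  obtain ⟨A, B, hAB, hun, A₀, hA₀, h1, hd, hcomp, hdeg⟩ := hH
  refine ⟨A₀.toFinset, (A \ A₀).toFinset, B.toFinset, ?_, ?_, ?_, ?_, ?_, ?_, ?_⟩
  · rw [Set.disjoint_toFinset]
    exact Set.disjoint_sdiff_right
  · ext w
    have hw : w ∈ A ∪ B := hun ▸ Set.mem_univ w
    have h0 := @hA₀ w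
    simp only [mem_union, Set.mem_toFinset, Set.mem_sdiff, Set.mem_union, mem_univ] at hw ⊢
    tauto
  · rw [Set.toFinset_nonempty]
    exact Set.nonempty_of_ncard_ne_zero (by omega)
  · rwa [← Set.ncard_eq_toFinset_card']
  · rw [coe_union, Set.coe_toFinset, Set.coe_toFinset, Set.coe_toFinset,
      Set.union_sdiff_cancel hA₀]
    exact hAB
  · simpa using hcomp
  · intro a ha
    have := hdeg a (by simpa using ha)
    rwa [Set.ncard_eq_toFinset_card', ← SimpleGraph.neighborFinset_def,
      SimpleGraph.card_neighborFinset_eq_degree] at this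

open Classical in
/-- The abstract count of good triples, translated to maps from the vertex set of `H`. -/
theorem card_isRelEmbedding_ge {W V : Type*} [Fintype W] [Fintype V] {H : SimpleGraph W}
    {A₀ A₁ B : Finset W} (hdisj : Disjoint A₀ A₁) (hun : A₀ ∪ A₁ ∪ B = univ)
    (hbip : H.IsBipartiteWith (A₀ ∪ A₁ : Finset W) B) (hcomp : ∀ a ∈ A₀, ∀ b ∈ B, H.Adj a b)
    (G : SimpleGraph V) {R : V → V → Prop} (hsymm : ∀ x y, R x y → R y x) :
    #{p : (A₀ → V) × (B → V) × (A₁ → V) | IsGoodTriple G R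
      (fun k : A₁ => ({j : B | H.Adj k j} : Finset B)) p.1 p.2.1 p.2.2} ≤
      #{φ : W → V | IsRelEmbedding H G R φ} := by
  have hB₀ : ∀ w ∈ A₀, w ∉ B := fun w hw hB =>
    Set.disjoint_left.1 hbip.disjoint (mem_coe.2 (mem_union_left _ hw)) (mem_coe.2 hB)
  have hB₁ : ∀ w ∈ A₁, w ∉ B := fun w hw hB =>
    Set.disjoint_left.1 hbip.disjoint (mem_coe.2 (mem_union_right _ hw)) (mem_coe.2 hB)
  have h₁₀ : ∀ w ∈ A₁, w ∉ A₀ := fun w hw h0 => Finset.disjoint_left.1 hdisj h0 hw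
  have hmem : ∀ w, w ∉ A₀ → w ∉ B → w ∈ A₁ := by
    intro w h0 hB
    have : w ∈ A₀ ∪ A₁ ∪ B := hun ▸ mem_univ w
    simp only [mem_union] at this
    tauto
  let φ : (A₀ → V) × (B → V) × (A₁ → V) → W → V := fun p w =>
    if h0 : w ∈ A₀ then p.1 ⟨w, h0⟩ else if hB : w ∈ B then p.2.1 ⟨w, hB⟩ else
      p.2.2 ⟨w, hmem w h0 hB⟩
  have hφ₀ : ∀ p w (h : w ∈ A₀), φ p w = p.1 ⟨w, h⟩ := fun p w h => by simp [φ, h]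
  have hφB : ∀ p w (h : w ∈ B), φ p w = p.2.1 ⟨w, h⟩ := fun p w h => by
    have : w ∉ A₀ := fun h0 => hB₀ w h0 h
    simp [φ, h, this]
  have hφ₁ : ∀ p w (h : w ∈ A₁), φ p w = p.2.2 ⟨w, h⟩ := fun p w h => by
    simp [φ, h₁₀ w h, hB₁ w h]
  have hAA : ∀ u v, H.Adj u v → (u ∈ A₀ ∪ A₁ ∧ v ∈ B) ∨ (u ∈ B ∧ v ∈ A₀ ∪ A₁) := by
    intro u v huv
    simpa using hbip.mem_of_adj huv
  have hcase : ∀ w, w ∈ A₀ ∨ w ∈ A₁ ∨ w ∈ B := by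
    intro w
    by_cases h0 : w ∈ A₀
    · exact Or.inl h0
    · by_cases hB : w ∈ B
      · exact Or.inr (Or.inr hB)
      · exact Or.inr (Or.inl (hmem w h0 hB))
  refine card_le_card_of_injOn φ ?_ ?_
  · rintro p hp
    simp only [coe_filter, Set.mem_ofPred_eq, mem_univ, true_and] at hp ⊢
    have hAB : ∀ u v, u ∈ A₀ ∪ A₁ → v ∈ B → H.Adj u v → G.Adj (φ p u) (φ p v) := by
      intro u v hu hv huv
      rcases mem_union.1 hu with h | h
      · rw [hφ₀ p u h, hφB p v hv]
        exact hp.adj_xy _ _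
      · rw [hφ₁ p u h, hφB p v hv]
        exact (hp.adj_yz ⟨u, h⟩ ⟨v, hv⟩ (by simpa using huv)).symm
    refine ⟨fun u v huv => ?_, fun u v hne huv hRuv => ?_⟩
    · rcases hAA u v huv with ⟨hu, hv⟩ | ⟨hu, hv⟩
      · exact hAB u v hu hv huv
      · exact (hAB v u hv hu huv.symm).symm
    · rcases hcase u with hu | hu | hu <;> rcases hcase v with hv | hv | hv
      · rw [hφ₀ p u hu, hφ₀ p v hv] at hRuv
        exact hp.indep_x _ _ (by simpa using hne) hRuv
      · rw [hφ₀ p u hu, hφ₁ p v hv] at hRuv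
        exact hp.free_xz _ _ hRuv
      · exact huv (hcomp u hu v hv)
      · rw [hφ₁ p u hu, hφ₀ p v hv] at hRuv
        exact hp.free_xz _ _ (hsymm _ _ hRuv)
      · rw [hφ₁ p u hu, hφ₁ p v hv] at hRuv
        exact hp.indep_z _ _ (by simpa using hne) hRuv
      · rw [hφ₁ p u hu, hφB p v hv] at hRuv
        exact hp.free_yz ⟨u, hu⟩ ⟨v, hv⟩ (by simpa using huv) (hsymm _ _ hRuv)
      · exact huv (hcomp v hv u hu).symm
      · rw [hφB p u hu, hφ₁ p v hv] at hRuv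
        exact hp.free_yz ⟨v, hv⟩ ⟨u, hu⟩ (by simpa using fun h : H.Adj v u => huv h.symm) hRuv
      · rw [hφB p u hu, hφB p v hv] at hRuv
        exact hp.indep_y _ _ (by simpa using hne) hRuv
  · intro p _ p' _ h
    refine Prod.ext ?_ (Prod.ext ?_ ?_)
    · funext w
      have := congrFun h w
      rwa [hφ₀ p w w.2, hφ₀ p' w w.2] at this
    · funext w
      have := congrFun h w
      rwa [hφB p w w.2, hφB p' w w.2] at this
    · funext w
      have := congrFun h w
      rwa [hφ₁ p w w.2, hφ₁ p' w w.2] at this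

open Classical in
theorem SimpleGraph.IsDBounded.exists_card_isRelEmbedding_ge {W : Type*} [Fintype W]
    {H : SimpleGraph W} {d : ℕ} (hH : H.IsDBounded d) {c : ℝ} (hc : 0 < c) (hc1 : c ≤ 1) :
    ∃ M α : ℝ, 0 < M ∧ 0 < α ∧ ∀ (V : Type*) [Fintype V] (G : SimpleGraph V) (R : V → V → Prop)
      (τ q : ℝ), (∀ x y, R x y → R y x) → 0 ≤ τ → SparseRel R c τ → 0 < q → q ≤ 1 →
      0 < Fintype.card V → q * (Fintype.card V : ℝ) ^ 2 = ∑ v, (G.degree v : ℝ) →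
      M * τ ≤ q ^ d * Fintype.card V →
      α * q ^ H.edgeSet.ncard * (Fintype.card V : ℝ) ^ Fintype.card W ≤
        #{φ : W → V | IsRelEmbedding H G R φ} := by
  obtain ⟨A₀, A₁, B, hdisj, hun, hne, hcard, hbip, hcomp, hdeg⟩ := hH.exists_finset
  have hAB : Disjoint (A₀ ∪ A₁) B := by
    rw [← Finset.disjoint_coe]
    exact hbip.disjoint
  have hedge : H.edgeSet.ncard = #A₀ * #B + ∑ k ∈ A₁, H.degree k := by
    rw [Set.ncard_eq_toFinset_card', ← SimpleGraph.edgeFinset,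
      ← SimpleGraph.isBipartiteWith_sum_degrees_eq_card_edges hbip, sum_union hdisj]
    congr 1
    rw [← smul_eq_mul, ← sum_const]
    refine sum_congr rfl fun a ha => ?_
    rw [← SimpleGraph.card_neighborFinset_eq_degree]
    congr 1
    ext b
    rw [SimpleGraph.mem_neighborFinset]
    refine ⟨fun h => ?_, hcomp a ha b⟩
    exact mem_coe.1 (hbip.mem_of_mem_adj (mem_coe.2 (mem_union_left _ ha)) h)
  have hW : Fintype.card W = #A₀ + #A₁ + #B := by
    rw [← card_univ, ← hun, card_union_of_disjoint hAB, card_union_of_disjoint hdisj]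
  -- If `B` is empty, `H` has no edges and independent tuples indexed by `W` suffice; the count of
  -- triples needs `B` nonempty.
  rcases B.eq_empty_or_nonempty with hB | hB
  · have hadj : ∀ u v, ¬ H.Adj u v := by
      intro u v huv
      have := hbip.mem_of_adj huv
      simp [hB] at this
    obtain ⟨M, γ, hM, hγ, h⟩ := exists_card_independent c hc W
    refine ⟨M, γ, hM, hγ, fun V _ G R τ q hsymm hτ hR hq0 hq1 hn hq hMτ => ?_⟩
    have hdeg0 : H.edgeSet.ncard = 0 := by
      rw [Set.ncard_eq_zero, SimpleGraph.edgeSet_eq_empty]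
      ext u v
      simp [hadj]
    have h1 := h V R τ hsymm hτ hR (fun _ => univ) fun _ => by
      rw [card_univ]
      refine hMτ.trans (mul_le_of_le_one_left (Nat.cast_nonneg _) (pow_le_one₀ hq0.le hq1))
    rw [hdeg0, pow_zero, mul_one]
    rw [prod_const, card_univ, card_univ] at h1
    refine h1.trans (Nat.cast_le.2 (card_le_card fun φ hφ => ?_))
    exact mem_filter.2 ⟨mem_univ _, fun u v huv => (hadj u v huv).elim,
      fun u v huv _ => (mem_filter.1 hφ).2 u v huv⟩
  · have : Nonempty A₀ := hne.coe_sort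
    have : Nonempty B := hB.coe_sort
    have hS : ∀ k ∈ A₁, #({j : B | H.Adj k j} : Finset B) = H.degree k := by
      intro k hk
      rw [← SimpleGraph.card_neighborFinset_eq_degree]
      refine card_bij (fun j _ => (j : W)) ?_ ?_ ?_
      · intro j hj
        simpa using hj
      · intro j _ j' _ h
        exact Subtype.ext h
      · intro b hb
        rw [SimpleGraph.mem_neighborFinset] at hb
        have hbB : b ∈ B :=
          mem_coe.1 (hbip.mem_of_mem_adj (mem_coe.2 (mem_union_right _ hk)) hb)
        exact ⟨⟨b, hbB⟩, by simpa using hb, rfl⟩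
    obtain ⟨M, α, hM, hα, h⟩ := exists_card_isGoodTriple_ge A₀ B A₁
      (fun k : A₁ => ({j : B | H.Adj k j} : Finset B)) d (by simpa using hcard)
      (fun k => (hS k k.2).trans_le (hdeg k k.2)) c hc hc1
    refine ⟨M, α, hM, hα, fun V _ G R τ q hsymm hτ hR hq0 hq1 hn hq hMτ => ?_⟩
    have h1 := h V G R τ q hsymm hτ hR hq0 hq1 hn hq hMτ
    have h2 : ∑ k : A₁, #({j : B | H.Adj k j} : Finset B) = ∑ k ∈ A₁, H.degree k := by
      rw [← sum_coe_sort A₁]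
      exact sum_congr rfl fun k _ => hS k k.2
    simp only [Fintype.card_coe] at h1
    rw [h2, ← hedge, show #A₀ + #B + #A₁ = Fintype.card W by omega] at h1
    refine h1.trans (le_trans (le_of_eq ?_)
      (Nat.cast_le.2 (card_isRelEmbedding_ge hdisj hun hbip hcomp G hsymm)))
    congr!

/-! ### Density and the main theorem -/

open Classical in
theorem SimpleGraph.sum_degree_eq_two_mul_ncard {V : Type*} [Fintype V] (G : SimpleGraph V) :
    ∑ v, (G.degree v : ℝ) = 2 * G.edgeSet.ncard := by
  rw [Set.ncard_eq_toFinset_card', ← SimpleGraph.edgeFinset]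
  exact_mod_cast G.sum_degrees_eq_twice_card_edges

/-- The hypothesis gives `q ≥ C * (t / n) ^ (1 / d)`; take `d`-th powers and use `C ≤ C ^ d`. -/
theorem mul_le_density_pow_mul {C t n e : ℝ} {d : ℕ} (hd : 1 ≤ d) (hC : 1 ≤ C) (ht : 0 < t)
    (hn : 0 < n) (h : C * t ^ (1 / (d : ℝ)) * n ^ (2 - 1 / (d : ℝ)) ≤ e) :
    0 < 2 * e / n ^ 2 ∧ C * t ≤ (2 * e / n ^ 2) ^ d * n := by
  have hu : (t ^ (1 / (d : ℝ))) ^ d = t := by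
    rw [one_div]; exact Real.rpow_inv_natCast_pow ht.le (by omega)
  have hv : (n ^ (1 / (d : ℝ))) ^ d = n := by
    rw [one_div]; exact Real.rpow_inv_natCast_pow hn.le (by omega)
  have hu0 : 0 < t ^ (1 / (d : ℝ)) := Real.rpow_pos_of_pos ht _
  have hv0 : 0 < n ^ (1 / (d : ℝ)) := Real.rpow_pos_of_pos hn _
  rw [Real.rpow_sub hn, Real.rpow_two] at h
  set u := t ^ (1 / (d : ℝ))
  set v := n ^ (1 / (d : ℝ))
  have hq : C * u / v ≤ 2 * e / n ^ 2 := by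
    rw [le_div_iff₀ (by positivity)]
    have h1 : C * u / v * n ^ 2 = C * u * (n ^ 2 / v) := by ring
    have h2 : 0 < C * u * (n ^ 2 / v) := by positivity
    linarith
  have hpos : 0 < C * u / v := by positivity
  refine ⟨hpos.trans_le hq, ?_⟩
  calc C * t ≤ C ^ d * t := by
        gcongr
        exact le_self_pow₀ hC (by omega)
    _ = (C * u / v) ^ d * n := by
        rw [div_pow, mul_pow, hu, hv]
        field_simp
    _ ≤ _ := by gcongr

theorem theorem1p1 {W : Type*} [Fintype W] (d : ℕ) (H : SimpleGraph W) (hH : H.IsDBounded d)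
    (c : ℝ) (hc : 0 < c) :
    ∃ C α : ℝ, 0 < C ∧ 0 < α ∧
      ∀ (V : Type*) [Fintype V] (t : ℝ) (Γ G : SimpleGraph V),
        0 < t → Γ.IsSparse c t → G ≤ Γ →
        C * t ^ (1 / (d : ℝ)) * (Fintype.card V : ℝ) ^ (2 - 1 / (d : ℝ)) ≤
          (G.edgeSet.ncard : ℝ) →
        α * (2 * (G.edgeSet.ncard : ℝ) / (Fintype.card V : ℝ) ^ 2) ^ H.edgeSet.ncard *
            (Fintype.card V : ℝ) ^ Fintype.card W ≤
          ((H.inducedCopies G Γ).ncard : ℝ) := by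
  classical
  have hd : 1 ≤ d := by
    obtain ⟨A, B, -, -, A₀, -, h1, h2, -⟩ := hH
    omega
  have hW : 0 < Fintype.card W := by
    obtain ⟨A, B, -, -, A₀, -, h1, -⟩ := hH
    obtain ⟨w, -⟩ := Set.nonempty_of_ncard_ne_zero (s := A₀) (by omega)
    exact Fintype.card_pos_iff.2 ⟨w⟩
  obtain ⟨c', hc', hc1, hcc⟩ : ∃ c' : ℝ, 0 < c' ∧ c' ≤ 1 ∧ 2 * c' ≤ c := by
    refine ⟨min c 1 / 2, by positivity, ?_, ?_⟩
    · linarith [min_le_right c 1]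
    · linarith [min_le_left c 1]
  obtain ⟨M, α, hM, hα, h⟩ := hH.exists_card_isRelEmbedding_ge hc' hc1
  have hWW : (0 : ℝ) < (Fintype.card W : ℝ) ^ Fintype.card W := by positivity
  -- The second term turns `C * t` into at least `M * τ` for `τ = (1 + 1 / c') * t`; the denominator
  -- of `α` passes from maps to copies.
  refine ⟨max 1 (M * (1 + 1 / c')), α / (Fintype.card W : ℝ) ^ Fintype.card W, by positivity,
    by positivity, ?_⟩
  intro V _ t Γ G ht hΓ hG he
  rcases Nat.eq_zero_or_pos (Fintype.card V) with hn | hn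
  · rw [hn, Nat.cast_zero, zero_pow hW.ne', mul_zero]
    exact Nat.cast_nonneg _
  have hn' : (0 : ℝ) < Fintype.card V := by exact_mod_cast hn
  obtain ⟨hq0, hqd⟩ := mul_le_density_pow_mul hd (le_max_left _ _) ht hn' he
  -- For `t < 1` singletons are tested by sparseness, so `Γ` has no edges, against `q > 0`.
  have ht1 : 1 ≤ t := by
    by_contra! hlt
    rw [hΓ.eq_bot hc hlt.le, le_bot_iff] at hG
    simp [hG] at hq0
  set q := 2 * (G.edgeSet.ncard : ℝ) / (Fintype.card V : ℝ) ^ 2 with hqdef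
  have hq : q * (Fintype.card V : ℝ) ^ 2 = ∑ v, (G.degree v : ℝ) := by
    rw [G.sum_degree_eq_two_mul_ncard, hqdef]
    field_simp
  have hq1 : q ≤ 1 := by
    refine le_of_mul_le_mul_right ?_ (pow_pos hn' 2)
    rw [hq, one_mul]
    calc ∑ v, (G.degree v : ℝ) ≤ ∑ _v : V, (Fintype.card V : ℝ) :=
          sum_le_sum fun v _ => Nat.cast_le.2 (G.degree_lt_card_verts v).le
      _ = (Fintype.card V : ℝ) ^ 2 := by
          rw [sum_const, nsmul_eq_mul, card_univ, sq]
  have h1 := h V G (fun x y => Γ.Adj x y ∨ x = y) ((1 + 1 / c') * t) q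
    (fun x y hxy => hxy.imp SimpleGraph.Adj.symm Eq.symm) (by positivity)
    (hΓ.sparseRel ht1 hc' hcc fun _ _ h => h) hq0 hq1 hn hq (by
      refine le_trans ?_ hqd
      rw [← mul_assoc]
      exact mul_le_mul_of_nonneg_right (le_max_right _ _) ht.le)
  have h2 : (#{φ : W → V | IsRelEmbedding H G (fun x y => Γ.Adj x y ∨ x = y) φ} : ℝ) ≤
      (Fintype.card W : ℝ) ^ Fintype.card W * (H.inducedCopies G Γ).ncard := by
    exact_mod_cast card_isRelEmbedding_le H G Γ
  have h3 := h1.trans (le_trans (le_of_eq (by congr!)) h2)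
  rw [div_mul_eq_mul_div, div_mul_eq_mul_div, div_le_iff₀ hWW]
  linarith
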